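/- **Setting.** Consider the plant $$\dot x=Ax+Bu+Ep(q)+E_ww,\qquad y=Cx+Du+F_ww,\qquad q=C_qx,$$ with $x\in\mathbb R^{n_x}$, $u\in\mathbb R^{n_u}$, $y\in\mathbb R^{n_y}$, $w\in\mathbb R^{n_w}$, constant real matrices, $D=0$, $F_w=0$, and a globally Lipschitz function $p:\mathbb R^{n_q}\to\mathbb R^{n_p}$ with $p(0)=0$. The disturbance $w$ is measurable with $\|w\|_\infty\le\omega_0$, where $\omega_0>0$ is arbitrary and $\|w\|_\infty$ is the (essential) supremum of $\|w(t)\|$ over $t\ge0$. For matrices $K_1,K_2,L_1,L_2$ put $k(x)=K_1x+K_2p(C_qx)$. *Continuous-time closed loop.* The observer is $\dot{\hat x}=A\hat x+Bu+Ep(C_q\hat x+L_1(\hat y-y))+L_2(\hat y-y)$ with $\hat y=C\hat x+Du$, and $u=k(\hat x)$. Write $e=x-\hat x$ and $z=(x,e)$. *Event-triggered closed loop (configuration II).* The observer receives the sampled output $y_s$ in place of $y$, and $u=k(\hat x_s)$, where $y_s(t)=y(t^y_k)$ for $t\in[t^y_k,t^y_{k+1})$ and $\hat x_s(t)=\hat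 x(t^u_k)$ for $t\in[t^u_k,t^u_{k+1})$. Here $t^y_0=t^u_0=0$ and $$t^y_{k+1}=\inf\{t\ge t^y_k+\tau_y:\ \|y(t^y_k)-y(t)\|>\sigma_y\|y(t)\|+\epsilon_y\},$$ $$t^u_{k+1}=\inf\{t\ge t^u_k+\tau_u:\ \|\hat x(t^u_k)-\hat x(t)\|>\sigma_u\|\hat x(t)\|+\epsilon_u\},$$ with value $+\infty$ if there is no further event. In each rule the signal is monitored while the old sample is in force; precisely, $t_{k+1}\ge t_k+\tau$, the threshold is not exceeded on $[t_k+\tau,t_{k+1})$, and if $t_{k+1}<\infty$ then the threshold is reached (inequality $\ge$) at $t_{k+1}$. Solutions of the differential equations are Carathéodory solutions on $[0,\infty)$. **Theorem.** Suppose that there are $\alpha_0>0$, a symmetric positive definite matrix $P$ and matrices $K_1,K_2,L_1,L_2$ such that $V(z)=z^\top Pz$ satisfies $\dot V\le-\alpha_0V$ along the continuous-time closed loop with $w\equiv0$, that is, $\nabla V(z)f(z)\le-\alpha_0V(z)$ for all $z$, where $\dot z=f(z)$ is that closed loop. Then, for these gain matrices, positive numbers $\tau_y,\sigma_y,\epsilon_y,\tau_u,\sigma_u,\epsilon_u$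 can be chosen such that the event-triggered closed loop is input-to-state practically stable (ISpS) with respect to $w$: for every initial state $(x(0),\hat x(0))$ and every such $w$ there is a trajectory on $[0,\infty)$, and there are $\beta_1\in\mathcal{KL}$, $\beta_2\in\mathcal K$ and $d\ge0$ such that every trajectory, for every such $w$, satisfies $$\|z(t)\|\le\beta_1(\|z(0)\|,t)+\beta_2(\|w\|_\infty)+d\qquad\text{for all }t\ge0.$$ Moreover, Zeno behaviour is excluded: along every such trajectory, each of the two event-triggering mechanisms has only finitely many events in any bounded time interval. -/

import Mathlib

open MeasureTheory Set Filter Topology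

noncomputable section

namespace EventTriggered

/-- Column vectors of length `n`, with the Euclidean norm. -/
abbrev Vec (n : ℕ) := EuclideanSpace ℝ (Fin n)

/-- The product of a matrix with a column vector, on Euclidean spaces. -/
abbrev act {m n : ℕ} (M : Matrix (Fin m) (Fin n) ℝ) (v : Vec n) : Vec m :=
  Matrix.toEuclideanLin M v

local infixr:73 " ⬝ₑ " => act

/-- The space of `z = (x, e)`, with the Euclidean norm. -/
abbrev State (n : ℕ) := EuclideanSpace ℝ (Fin n ⊕ Fin n)

/-- The stacked vector `(x, e)`. -/
def stack {n : ℕ} (x e : Vec n) : State n := WithLp.toLp 2 (Sum.elim x e)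

/-- The first block of `z = (x, e)`. -/
def fstBlock {n : ℕ} (z : State n) : Vec n := WithLp.toLp 2 (fun i => z (Sum.inl i))

/-- The second block of `z = (x, e)`. -/
def sndBlock {n : ℕ} (z : State n) : Vec n := WithLp.toLp 2 (fun i => z (Sum.inr i))

/-! ### Comparison functions and input-to-state practical stability -/

/-- Class `𝒦`: continuous and strictly increasing on `[0, ∞)`, zero at `0`. -/
structure ClassK (β : ℝ → ℝ) : Prop where
  continuousOn : ContinuousOn β (Ici 0)
  strictMonoOn : StrictMonoOn β (Ici 0)
  map_zero : β 0 = 0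

/-- Class `𝒦ℒ`: continuous on `[0, ∞)²`, of class `𝒦` in the first variable, and nonincreasing with
limit `0` in the second one. -/
structure ClassKL (β : ℝ → ℝ → ℝ) : Prop where
  continuousOn : ContinuousOn (fun q : ℝ × ℝ => β q.1 q.2) (Ici 0 ×ˢ Ici 0)
  classK : ∀ t, 0 ≤ t → ClassK (fun r => β r t)
  antitoneOn : ∀ r, 0 ≤ r → AntitoneOn (β r) (Ici 0)
  tendsto_zero : ∀ r, 0 ≤ r → Tendsto (β r) atTop (𝓝 0)

/-- The essential supremum of `‖w t‖` over `t ≥ 0`, in `[0, ∞]`. -/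
def inputNorm {m : ℕ} (w : ℝ → Vec m) : ENNReal := eLpNorm w ⊤ (volume.restrict (Ici 0))

/-- The disturbances: measurable on `[0, ∞)`, with `‖w‖_∞ ≤ ω₀`. -/
def Disturbances (m : ℕ) (ω₀ : ℝ) : Set (ℝ → Vec m) :=
  {w | AEStronglyMeasurable w (volume.restrict (Ici 0)) ∧ inputNorm w ≤ ENNReal.ofReal ω₀}

/-- Input-to-state practical stability of a system with inputs in `W` whose trajectories for the
input `w` are the `z` with `Sol w z`: from every initial state and for every input there is a
trajectory on `[0, ∞)`, and all trajectories satisfy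
`‖z t‖ ≤ β₁ (‖z 0‖, t) + β₂ (‖w‖_∞) + d`. -/
def IsISpS {Z : Type*} [NormedAddCommGroup Z] {m : ℕ} (W : Set (ℝ → Vec m))
    (Sol : (ℝ → Vec m) → (ℝ → Z) → Prop) : Prop :=
  (∀ w ∈ W, ∀ z₀ : Z, ∃ z : ℝ → Z, Sol w z ∧ z 0 = z₀) ∧
  ∃ (β₁ : ℝ → ℝ → ℝ) (β₂ : ℝ → ℝ) (d : ℝ), ClassKL β₁ ∧ ClassK β₂ ∧ 0 ≤ d ∧
    ∀ w ∈ W, ∀ z : ℝ → Z, Sol w z →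
      ∀ t, 0 ≤ t → ‖z t‖ ≤ β₁ ‖z 0‖ t + β₂ (inputNorm w).toReal + d

/-! ### Plant, observer and controller -/

/-- The data of the plant `ẋ = A x + B u + E p(q) + E_w w`, `y = C x + D u + F_w w`, `q = C_q x`. -/
structure Plant (nx nu ny nq np nw : ℕ) where
  A : Matrix (Fin nx) (Fin nx) ℝ
  B : Matrix (Fin nx) (Fin nu) ℝ
  C : Matrix (Fin ny) (Fin nx) ℝ
  D : Matrix (Fin ny) (Fin nu) ℝ
  Cq : Matrix (Fin nq) (Fin nx) ℝ
  E : Matrix (Fin nx) (Fin np) ℝ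
  Ew : Matrix (Fin nx) (Fin nw) ℝ
  Fw : Matrix (Fin ny) (Fin nw) ℝ
  p : Vec nq → Vec np

/-- The matrices of the controller (`K₁`, `K₂`) and of the observer (`L₁`, `L₂`). -/
structure Gains (nx nu ny nq np : ℕ) where
  K₁ : Matrix (Fin nu) (Fin nx) ℝ
  K₂ : Matrix (Fin nu) (Fin np) ℝ
  L₁ : Matrix (Fin nq) (Fin ny) ℝ
  L₂ : Matrix (Fin nx) (Fin ny) ℝ

section Fields

variable {nx nu ny nq np nw : ℕ} (S : Plant nx nu ny nq np nw) (G : Gains nx nu ny nq np)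

/-- The right-hand side of the plant equation. -/
def plantField (x : Vec nx) (u : Vec nu) (w : Vec nw) : Vec nx :=
  S.A ⬝ₑ x + S.B ⬝ₑ u + S.E ⬝ₑ S.p (S.Cq ⬝ₑ x) + S.Ew ⬝ₑ w

/-- The measured output `y`. -/
def output (x : Vec nx) (u : Vec nu) (w : Vec nw) : Vec ny :=
  S.C ⬝ₑ x + S.D ⬝ₑ u + S.Fw ⬝ₑ w

/-- The predicted output `ŷ = C x̂ + D u`. -/
def predictedOutput (xh : Vec nx) (u : Vec nu) : Vec ny := S.C ⬝ₑ xh + S.D ⬝ₑ u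

/-- The right-hand side of the observer equation, when the observer is fed with `y`:
`A x̂ + B u + E p(C_q x̂ + L₁ (ŷ - y)) + L₂ (ŷ - y)`. -/
def observerField (xh : Vec nx) (u : Vec nu) (y : Vec ny) : Vec nx :=
  S.A ⬝ₑ xh + S.B ⬝ₑ u
    + S.E ⬝ₑ S.p (S.Cq ⬝ₑ xh + G.L₁ ⬝ₑ (predictedOutput S xh u - y))
    + G.L₂ ⬝ₑ (predictedOutput S xh u - y)

/-- The feedback law `k(x) = K₁ x + K₂ p(C_q x)`. -/
def feedback (x : Vec nx) : Vec nu := G.K₁ ⬝ₑ x + G.K₂ ⬝ₑ S.p (S.Cq ⬝ₑ x)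

/-- The right-hand side of the continuous-time closed loop in the variable `z = (x, e)`, with
`e = x - x̂` and `u = k(x̂)`. -/
def closedLoopField (z : State nx) (w : Vec nw) : State nx :=
  let x := fstBlock z
  let xh := x - sndBlock z
  let u := feedback S G xh
  stack (plantField S x u w)
    (plantField S x u w - observerField S G xh u (output S x u w))

end Fields

/-- The quadratic form `V(z) = zᵀ P z`. -/
def quadForm {n : ℕ} (P : Matrix (Fin n ⊕ Fin n) (Fin n ⊕ Fin n) ℝ) (z : State n) : ℝ :=
  z.ofLp ⬝ᵥ P.mulVec z.ofLp

/-! ### Event-triggering mechanisms -/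

/-- The parameters of an event-triggering mechanism. -/
structure TriggerParams where
  τ : ℝ
  σ : ℝ
  ε : ℝ

/-- All three parameters are positive. -/
structure TriggerParams.Pos (T : TriggerParams) : Prop where
  τ_pos : 0 < T.τ
  σ_pos : 0 < T.σ
  ε_pos : 0 < T.ε

/-- The triggering times generated from the signal `ξ` by the rule
`t₀ = 0`, `t_{k+1} = inf {t ≥ t_k + τ | ‖ξ(t_k) - ξ(t)‖ > σ ‖ξ(t)‖ + ε}`; they take the value `⊤`
from the first index on for which there is no further event.

In the rule, the signal is monitored under the sample that is still in force. As the update at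
`t_{k+1}` changes the dynamics from `t_{k+1}` on, the rule is stated through the signal up to
`t_{k+1}`: the waiting time `τ` has elapsed, the threshold was not exceeded on
`[t_k + τ, t_{k+1})`, and it has been reached at `t_{k+1}` if `t_{k+1}` is finite. So a trajectory
that touches the threshold without crossing it may trigger there or not. -/
structure IsTriggerSequence {n : ℕ} (T : TriggerParams) (ξ : ℝ → Vec n) (t : ℕ → EReal) :
    Prop where
  zero : t 0 = 0
  wait : ∀ k, t k + (T.τ : EReal) ≤ t (k + 1)
  quiet : ∀ k, ∀ s : ℝ, t k + (T.τ : EReal) ≤ s → (s : EReal) < t (k + 1) →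
    ‖ξ (t k).toReal - ξ s‖ ≤ T.σ * ‖ξ s‖ + T.ε
  fire : ∀ k, ∀ s : ℝ, t (k + 1) = s → T.σ * ‖ξ s‖ + T.ε ≤ ‖ξ (t k).toReal - ξ s‖

/-- `ξs` is the sampled signal: `ξs(s) = ξ(t_k)` for `s ∈ [t_k, t_{k+1})`. -/
def IsSampled {n : ℕ} (t : ℕ → EReal) (ξ ξs : ℝ → Vec n) : Prop :=
  ∀ k, ∀ s : ℝ, t k ≤ s → (s : EReal) < t (k + 1) → ξs s = ξ (t k).toReal

/-- Zeno behaviour does not occur: only finitely many events in finite time. -/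
def NoZeno (t : ℕ → EReal) : Prop := ∀ T : ℝ, {k | t k ≤ (T : EReal)}.Finite

/-- `x` is a (Carathéodory) solution on `[0, ∞)` of `ẋ(t) = v(t)` for almost every `t`. -/
def IsCaratheodory {n : ℕ} (x v : ℝ → Vec n) : Prop :=
  ∀ t, 0 ≤ t → IntervalIntegrable v volume 0 t ∧ x t = x 0 + ∫ s in (0 : ℝ)..t, v s

/-- A trajectory of the closed loop in which both the output and the observer state are transmitted
by event-triggering mechanisms: `ty` and `tu` are the triggering times of the output and of the
controller channel, `ys` and `xs` the sampled signals. The observer is fed with `ys`, and the input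
is `u = K₁ x̂_s + K₂ p(C_q x̂_s)`. -/
structure IsTriggeredTrajectory {nx nu ny nq np nw : ℕ} (S : Plant nx nu ny nq np nw)
    (G : Gains nx nu ny nq np) (Ty Tu : TriggerParams) (w : ℝ → Vec nw)
    (x xh xs : ℝ → Vec nx) (ys : ℝ → Vec ny) (ty tu : ℕ → EReal) : Prop where
  output_trigger : IsTriggerSequence Ty (fun t => output S (x t) (feedback S G (xs t)) (w t)) ty
  output_sampled : IsSampled ty (fun t => output S (x t) (feedback S G (xs t)) (w t)) ys
  control_trigger : IsTriggerSequence Tu xh tu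
  control_sampled : IsSampled tu xh xs
  plant : IsCaratheodory x (fun t => plantField S (x t) (feedback S G (xs t)) (w t))
  observer : IsCaratheodory xh (fun t => observerField S G (xh t) (feedback S G (xs t)) (ys t))

/-- `z = (x, e)`, `e = x - x̂`, along a trajectory of the event-triggered closed loop. -/
def IsTriggeredSolution {nx nu ny nq np nw : ℕ} (S : Plant nx nu ny nq np nw)
    (G : Gains nx nu ny nq np) (Ty Tu : TriggerParams) (w : ℝ → Vec nw) (z : ℝ → State nx) :
    Prop :=
  ∃ x xh xs ys ty tu, IsTriggeredTrajectory S G Ty Tu w x xh xs ys ty tu ∧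
    z = fun t => stack (x t) (x t - xh t)

end EventTriggered

end

namespace EventTriggered

/-! ### Sequences with a dwell time -/

section Dwell

variable {τ : ℝ} {t : ℕ → EReal}

/-! The event-triggered loop is a perturbation of the continuous-time loop. All fields are globally
Lipschitz, so the two right-hand sides differ by at most a constant times the two sampling errors
plus `‖w‖` (`exists_closedLoop_bounds`). If each sampling error is at most `η (‖z‖ + m)` with `m =
‖w‖_∞ + 1` and `η` small, the part proportional to `‖z‖` is absorbed by the decay of `V`. Gronwall's
inequality then gives exponential decay up to a multiple of `m` (`norm_le_of_lyapunov`).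

The error bound is a continuation argument (`sampling_error_le`, `sampling_errors_le`). After the
waiting time, the trigger rule itself bounds the error. During the waiting time the error is the
motion of the state since the last sample, which is small for small `τ` provided that the velocity
is bounded by the state. That proviso needs the error bound at earlier times, and the argument
returns it with `η / 2` in place of `η`; hence there is no first time of failure. As `m` grows with
the disturbance, the parameters do not depend on `ω₀`.

Existence rests on causality: samples up to a time depend only on the signal up to that time
(`held_congr`). Between events the equation has frozen samples and is Lipschitz, with a step length
depending only on the Lipschitz constant. The waiting times allow only finitely many events per step
(`SolvesUpTo.extend_by`), and they exclude Zeno behaviour, since `t_k ≥ k τ`. -/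

theorem mul_le_of_dwell (h0 : t 0 = 0) (hw : ∀ k, t k + (τ : EReal) ≤ t (k + 1)) (k : ℕ) :
    ((k * τ : ℝ) : EReal) ≤ t k := by
  induction k with
  | zero => simp [h0]
  | succ k ih =>
    refine le_trans ?_ (hw k)
    have : (((k + 1 : ℕ) * τ : ℝ) : EReal) = ((k * τ : ℝ) : EReal) + (τ : EReal) := by
      rw [← EReal.coe_add, Nat.cast_succ, add_one_mul]
    rw [this]
    gcongr

theorem monotone_of_dwell (hτ : 0 < τ) (hw : ∀ k, t k + (τ : EReal) ≤ t (k + 1)) : Monotone t := by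
  refine monotone_nat_of_le_succ fun k => le_trans ?_ (hw k)
  have : (0 : EReal) ≤ τ := by exact_mod_cast hτ.le
  simpa using add_le_add (le_refl (t k)) this

theorem exists_lt_of_dwell (hτ : 0 < τ) (h0 : t 0 = 0) (hw : ∀ k, t k + (τ : EReal) ≤ t (k + 1))
    (s : ℝ) : ∃ k, (s : EReal) < t k := by
  obtain ⟨k, hk⟩ := exists_nat_gt (s / τ)
  refine ⟨k, lt_of_lt_of_le ?_ (mul_le_of_dwell h0 hw k)⟩
  rw [div_lt_iff₀ hτ] at hk
  exact_mod_cast hk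

theorem noZeno_of_dwell (hτ : 0 < τ) (h0 : t 0 = 0) (hw : ∀ k, t k + (τ : EReal) ≤ t (k + 1)) :
    NoZeno t := by
  intro T
  obtain ⟨k, hk⟩ := exists_lt_of_dwell hτ h0 hw T
  refine (finite_lt_nat k).subset fun j hj => ?_
  by_contra hkj
  exact absurd (hk.trans_le ((monotone_of_dwell hτ hw (not_lt.1 hkj)).trans hj)) (lt_irrefl _)

theorem exists_mem_interval_of_dwell (hτ : 0 < τ) (h0 : t 0 = 0)
    (hw : ∀ k, t k + (τ : EReal) ≤ t (k + 1)) {s : ℝ} (hs : 0 ≤ s) :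
    ∃ k, t k ≤ s ∧ (s : EReal) < t (k + 1) := by
  classical
  have hex := exists_lt_of_dwell hτ h0 hw s
  obtain ⟨k, hk⟩ : ∃ k, Nat.find hex = k + 1 := by
    refine Nat.exists_eq_succ_of_ne_zero fun h => ?_
    have := Nat.find_spec hex
    rw [h, h0] at this
    exact absurd hs (not_le.2 (by exact_mod_cast this))
  refine ⟨k, not_lt.1 (Nat.find_min hex (by omega)), ?_⟩
  rw [← hk]
  exact Nat.find_spec hex

theorem interval_unique_of_dwell (hτ : 0 < τ) (hw : ∀ k, t k + (τ : EReal) ≤ t (k + 1))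
    {s : EReal} {j k : ℕ} (hj : t j ≤ s) (hj' : s < t (j + 1)) (hk : t k ≤ s)
    (hk' : s < t (k + 1)) : j = k := by
  have hm := monotone_of_dwell hτ hw
  have h1 : j < k + 1 := hm.reflect_lt (hj.trans_lt hk')
  have h2 : k < j + 1 := hm.reflect_lt (hk.trans_lt hj')
  omega

/-- Signals are read at `(t k).toReal`; this justifies the passage to real times for events that
have occurred. -/
theorem eq_coe_toReal_of_dwell (hτ : 0 < τ) (h0 : t 0 = 0)
    (hw : ∀ k, t k + (τ : EReal) ≤ t (k + 1)) {k : ℕ} {s : ℝ} (hk : t k ≤ s) :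
    0 ≤ (t k).toReal ∧ (((t k).toReal : ℝ) : EReal) = t k ∧ (t k).toReal ≤ s := by
  have h1 : 0 ≤ t k := h0 ▸ monotone_of_dwell hτ hw (Nat.zero_le k)
  have h2 : (((t k).toReal : ℝ) : EReal) = t k :=
    EReal.coe_toReal (ne_top_of_le_ne_top (EReal.coe_ne_top s) hk)
      (ne_bot_of_le_ne_bot (by simp) h1)
  refine ⟨EReal.toReal_nonneg h1, h2, ?_⟩
  rw [← h2] at hk
  exact_mod_cast hk

end Dwell

/-! ### The triggering times generated by a signal -/

section Generated

variable {n : ℕ}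

/-- The times at which the rule may trigger after a sample at time `a`. -/
def triggerSet (T : TriggerParams) (ξ : ℝ → Vec n) (a : EReal) : Set ℝ :=
  {s | a + (T.τ : EReal) ≤ s ∧ T.σ * ‖ξ s‖ + T.ε ≤ ‖ξ a.toReal - ξ s‖}

/-- The triggering times generated by `ξ`, with events as early as possible. -/
noncomputable def eventTime (T : TriggerParams) (ξ : ℝ → Vec n) : ℕ → EReal
  | 0 => 0
  | k + 1 => sInf ((fun s : ℝ => (s : EReal)) '' triggerSet T ξ (eventTime T ξ k))

open Classical in
/-- The sampled signal of `ξ` along its triggering times. -/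
noncomputable def held (T : TriggerParams) (ξ : ℝ → Vec n) (s : ℝ) : Vec n :=
  if h : ∃ k, eventTime T ξ k ≤ s ∧ (s : EReal) < eventTime T ξ (k + 1) then
    ξ (eventTime T ξ h.choose).toReal else 0

variable {T : TriggerParams} {ξ η : ℝ → Vec n}

theorem eventTime_dwell (T : TriggerParams) (ξ : ℝ → Vec n) (k : ℕ) :
    eventTime T ξ k + (T.τ : EReal) ≤ eventTime T ξ (k + 1) := by
  rw [eventTime]
  refine le_sInf ?_
  rintro _ ⟨s, hs, rfl⟩
  exact hs.1

/-- A finite infimum of trigger times is attained. -/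
theorem mem_triggerSet_of_sInf_eq (hξ : Continuous ξ) {a : EReal} {s : ℝ}
    (h : sInf ((fun s : ℝ => (s : EReal)) '' triggerSet T ξ a) = s) : s ∈ triggerSet T ξ a := by
  -- The non-strict inequality in `triggerSet` and the continuity of `ξ` make the set closed, so it
  -- contains a finite infimum.
  have hcl : IsClosed (triggerSet T ξ a) := by
    have h1 : IsClosed {s : ℝ | a + (T.τ : EReal) ≤ s} :=
      isClosed_le continuous_const continuous_coe_real_ereal
    have h2 : IsClosed {s : ℝ | T.σ * ‖ξ s‖ + T.ε ≤ ‖ξ a.toReal - ξ s‖} :=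
      isClosed_le (by fun_prop) (by fun_prop)
    exact h1.inter h2
  rw [← hcl.closure_eq, Metric.mem_closure_iff]
  intro ε hε
  have hlt : sInf ((fun s : ℝ => (s : EReal)) '' triggerSet T ξ a) < ((s + ε : ℝ) : EReal) := by
    rw [h]; exact_mod_cast lt_add_of_pos_right s hε
  obtain ⟨_, ⟨r, hr, rfl⟩, hr'⟩ := sInf_lt_iff.1 hlt
  refine ⟨r, hr, ?_⟩
  have h1 : (s : EReal) ≤ r := h ▸ sInf_le ⟨r, hr, rfl⟩
  have h1' : s ≤ r := by exact_mod_cast h1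
  have h2 : r < s + ε := EReal.coe_lt_coe_iff.1 hr'
  rw [Real.dist_eq, abs_lt]; constructor <;> linarith

/-- Nothing before an infimum lies in the trigger set, which gives `quiet`; `fire` needs the infimum
to be attained, hence continuity. The infimum of the empty set is `⊤`, the value for no further
event. -/
theorem isTriggerSequence_eventTime (hξ : Continuous ξ) :
    IsTriggerSequence T ξ (eventTime T ξ) where
  zero := rfl
  wait := eventTime_dwell T ξ
  quiet k s hs hs' := by
    by_contra hcon
    rw [eventTime] at hs'
    exact absurd hs' (not_lt.2 (sInf_le ⟨s, ⟨hs, (not_le.1 hcon).le⟩, rfl⟩))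
  fire k s hs := (mem_triggerSet_of_sInf_eq hξ (by rw [← hs, eventTime])).2

theorem held_eq (hτ : 0 < T.τ) {k : ℕ} {s : ℝ} (hk : eventTime T ξ k ≤ s)
    (hk' : (s : EReal) < eventTime T ξ (k + 1)) : held T ξ s = ξ (eventTime T ξ k).toReal := by
  have hex : ∃ k, eventTime T ξ k ≤ s ∧ (s : EReal) < eventTime T ξ (k + 1) := ⟨k, hk, hk'⟩
  rw [held, dif_pos hex, interval_unique_of_dwell hτ (eventTime_dwell T ξ) hex.choose_spec.1
    hex.choose_spec.2 hk hk']

theorem isSampled_held (hτ : 0 < T.τ) : IsSampled (eventTime T ξ) ξ (held T ξ) :=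
  fun _ _ hk hk' => held_eq hτ hk hk'

/-- The triggering times up to time `b` depend only on the signal up to time `b`. -/
theorem eventTime_congr (hτ : 0 < T.τ) (hξ : Continuous ξ) (hη : Continuous η) {b : ℝ}
    (h : ∀ s ≤ b, ξ s = η s) (k : ℕ) :
    eventTime T ξ k = eventTime T η k ∨
      ((b : EReal) < eventTime T ξ k ∧ (b : EReal) < eventTime T η k) := by
  induction k with
  | zero => exact Or.inl rfl
  | succ k ih =>
    rcases ih with ih | ⟨h1, h2⟩
    -- An event of one signal by time `b` is also a possible event of the other, so the infimum for
    -- the other is no later. Applied in both directions, this gives equality.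
    · have key : ∀ {ξ η : ℝ → Vec n}, Continuous ξ → (∀ s ≤ b, ξ s = η s) →
          eventTime T ξ k = eventTime T η k → eventTime T ξ (k + 1) ≤ b →
          eventTime T η (k + 1) ≤ eventTime T ξ (k + 1) := by
        intro ξ η hξ h ih hb
        obtain ⟨-, h3, h4⟩ :=
          eq_coe_toReal_of_dwell hτ (show eventTime T ξ 0 = 0 from rfl) (eventTime_dwell T ξ) hb
        have h5 := eq_coe_toReal_of_dwell hτ (show eventTime T ξ 0 = 0 from rfl)
          (eventTime_dwell T ξ)
          ((monotone_of_dwell hτ (eventTime_dwell T ξ) (Nat.le_succ k)).trans hb)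
        set r := (eventTime T ξ (k + 1)).toReal
        have hr : r ∈ triggerSet T ξ (eventTime T ξ k) :=
          mem_triggerSet_of_sInf_eq hξ (by rw [h3, eventTime])
        rw [← h3, eventTime]
        refine sInf_le ⟨r, ⟨ih ▸ hr.1, ?_⟩, rfl⟩
        rw [← ih, ← h _ h4, ← h _ h5.2.2]
        exact hr.2
      rcases le_or_gt (eventTime T ξ (k + 1)) b with hb | hb
      · have h1 := key hξ h ih hb
        exact Or.inl (le_antisymm (key hη (fun s hs => (h s hs).symm) ih.symm (h1.trans hb)) h1)
      · rcases le_or_gt (eventTime T η (k + 1)) b with hb' | hb'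
        · exact absurd (hb.trans_le (key hη (fun s hs => (h s hs).symm) ih.symm hb'))
            (not_lt.2 hb')
        · exact Or.inr ⟨hb, hb'⟩
    · exact Or.inr ⟨h1.trans_le (monotone_of_dwell hτ (eventTime_dwell T ξ) (Nat.le_succ k)),
        h2.trans_le (monotone_of_dwell hτ (eventTime_dwell T η) (Nat.le_succ k))⟩

theorem eventTime_eq_of_le (hτ : 0 < T.τ) (hξ : Continuous ξ) (hη : Continuous η) {b : ℝ}
    (h : ∀ s ≤ b, ξ s = η s) {k : ℕ} (hk : eventTime T ξ k ≤ b) :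
    eventTime T η k = eventTime T ξ k :=
  ((eventTime_congr hτ hξ hη h k).resolve_right fun h' => not_lt.2 hk h'.1).symm

theorem lt_eventTime_of_lt (hτ : 0 < T.τ) (hξ : Continuous ξ) (hη : Continuous η) {b s : ℝ}
    (hs : s ≤ b) (h : ∀ s ≤ b, ξ s = η s) {k : ℕ} (hk : (s : EReal) < eventTime T ξ k) :
    (s : EReal) < eventTime T η k := by
  rcases eventTime_congr hτ hξ hη h k with h' | h'
  · exact h' ▸ hk
  · exact lt_of_le_of_lt (by exact_mod_cast hs) h'.2

/-- The sampled signal up to time `b` depends only on the signal up to time `b`. -/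
theorem held_congr (hτ : 0 < T.τ) (hξ : Continuous ξ) (hη : Continuous η) {b s : ℝ}
    (h : ∀ s ≤ b, ξ s = η s) (hs0 : 0 ≤ s) (hs : s ≤ b) : held T ξ s = held T η s := by
  obtain ⟨k, hk, hk'⟩ := exists_mem_interval_of_dwell hτ (show eventTime T ξ 0 = 0 from rfl)
    (eventTime_dwell T ξ) hs0
  have hr := eq_coe_toReal_of_dwell hτ (show eventTime T ξ 0 = 0 from rfl) (eventTime_dwell T ξ) hk
  have he : eventTime T η k = eventTime T ξ k :=
    eventTime_eq_of_le hτ hξ hη h (hk.trans (by exact_mod_cast hs))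
  rw [held_eq hτ hk hk', held_eq hτ (he.symm ▸ hk) (lt_eventTime_of_lt hτ hξ hη hs h hk'), he]
  exact h _ (hr.2.2.trans hs)

end Generated

/-! ### Local solutions of Carathéodory equations with additive input -/

section Local

variable {E : Type*} [NormedAddCommGroup E] [NormedSpace ℝ E] [CompleteSpace E]

/-- Local existence for `ẋ = f(x) + g(t)`, with `f` globally Lipschitz and `g` locally integrable,
on a time interval whose length depends only on the Lipschitz constant. -/
theorem exists_local_solution {f : E → E} {K : NNReal} (hf : LipschitzWith K f) {g : ℝ → E}
    (T : ℝ) (hg : ∀ t, T ≤ t → IntervalIntegrable g volume T t) {h : ℝ} (hh : 0 < h)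
    (hK : K * h ≤ 1 / 2) (a : E) :
    ∃ φ : ℝ → E, Continuous φ ∧ φ T = a ∧
      ∀ t ∈ Icc T (T + h), φ t = a + ∫ s in T..t, (f (φ s) + g s) := by
  have hTh : T ≤ T + h := by linarith
  set c : ℝ → ℝ := fun t => (projIcc T (T + h) hTh t : ℝ) with hc
  have hcc : Continuous c := continuous_subtype_val.comp continuous_projIcc
  have hcm : ∀ t, c t ∈ Icc T (T + h) := fun t => (projIcc T (T + h) hTh t).2
  have hce : ∀ t ∈ Icc T (T + h), c t = t := fun t ht => by simp [hc, projIcc_of_mem hTh ht]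
  -- Subtracting the primitive `G` of `g` turns the equation into `ẋ = f (x + G t)`, which is
  -- continuous in time although `g` is only integrable. The clamped time `c` makes the functions
  -- involved continuous on all of `ℝ`.
  set G : ℝ → E := fun t => ∫ s in T..(c t), g s with hG
  have hGc : Continuous G := by
    have : ContinuousOn (fun t => ∫ s in T..t, g s) (Icc T (T + h)) := by
      have := intervalIntegral.continuousOn_primitive_interval (μ := volume) (f := g)
        (a := T) (b := T + h) ?_
      · rwa [uIcc_of_le hTh] at this
      · rw [uIcc_of_le hTh, integrableOn_Icc_iff_integrableOn_Ioc]
        exact (intervalIntegrable_iff_integrableOn_Ioc_of_le hTh).1 (hg _ hTh)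
    exact this.comp_continuous hcc hcm
  obtain ⟨M, hM⟩ := isCompact_Icc.exists_bound_of_continuousOn
    (s := Icc T (T + h)) (f := fun t => f (a + G t))
    (hf.continuous.comp (continuous_const.add hGc)).continuousOn
  have hM0 : 0 ≤ M := (norm_nonneg _).trans (hM T ⟨le_rfl, hTh⟩)
  lift M to NNReal using hM0
  lift h to NNReal using hh.le
  have hlip : ∀ t, LipschitzWith K (fun x => f (x + G t)) := fun t => by
    have := hf.comp (LipschitzWith.id.add (LipschitzWith.const (α := E) (G t)))
    simpa [Function.comp_def] using! this
  -- On the ball of radius `2 M h` the field is at most `M + K (2 M h) ≤ 2 M`, because `K h ≤ 1 /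
  -- 2`; so a solution stays in the ball for time `h`, whatever `M` is.
  have hpl : IsPicardLindelof (fun t x => f (x + G t)) (tmin := T) (tmax := T + h)
      ⟨T, le_rfl, hTh⟩ a (2 * M * h) 0 (M + K * (2 * M * h)) K := by
    refine ⟨fun t _ => (hlip t).lipschitzOnWith, fun x _ => ?_, fun t ht x hx => ?_, ?_⟩
    · exact (hf.continuous.comp (continuous_const.add hGc)).continuousOn
    · have h1 := (hlip t).dist_le_mul x a
      rw [dist_eq_norm] at h1
      have h2 : ‖f (x + G t)‖ ≤ ‖f (a + G t)‖ + ‖f (x + G t) - f (a + G t)‖ := by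
        simpa using norm_add_le (f (a + G t)) (f (x + G t) - f (a + G t))
      have h3 := mul_le_mul_of_nonneg_left (Metric.mem_closedBall.1 hx) K.2
      have h4 := hM t ht
      push_cast at h3 ⊢
      change (K : ℝ) * _ ≤ K * _ at h3
      linarith
    · simp only [add_sub_cancel_left, sub_self]
      rw [max_eq_left h.coe_nonneg]
      push_cast
      have : 0 ≤ (M : ℝ) * h := by positivity
      nlinarith
  obtain ⟨α, hα0, hα⟩ := hpl.exists_eq_forall_mem_Icc_hasDerivWithinAt₀
  have hαc : Continuous fun t => α (c t) :=
    ContinuousOn.comp_continuous (fun t ht => (hα t ht).continuousWithinAt) hcc hcm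
  refine ⟨fun t => α (c t) + G t, hαc.add hGc, ?_, fun t ht => ?_⟩
  · have : c T = T := hce T ⟨le_rfl, hTh⟩
    simp [hG, this, hα0]
  · have hsub : Icc T t ⊆ Icc T (T + h) := Icc_subset_Icc_right ht.2
    have hF : Continuous fun s => f (α (c s) + G s) := hf.continuous.comp (hαc.add hGc)
    have h1 : ∫ s in T..t, f (α (c s) + G s) = α t - α T := by
      refine intervalIntegral.integral_eq_sub_of_hasDeriv_right_of_le ht.1
        (fun s hs => ((hα s (hsub hs)).mono hsub).continuousWithinAt) (fun s hs => ?_)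
        (hF.intervalIntegrable _ _)
      have h2 := hα s (hsub (Ioo_subset_Icc_self hs))
      rw [hce s (hsub (Ioo_subset_Icc_self hs))]
      exact (h2.hasDerivAt (Icc_mem_nhds hs.1 (hs.2.trans_le ht.2))).hasDerivWithinAt
    rw [intervalIntegral.integral_add (hF.intervalIntegrable _ _) (hg t ht.1), h1, hα0]
    simp only [hG, hce t ht]
    abel

end Local

/-! ### Global existence for equations with two event-triggered signals -/

section Global

variable {E : Type*} [NormedAddCommGroup E] {a b : ℕ}

/-- The right-hand side `f (y_s, u_s, ξ) + g` along `ξ`, where `y_s` and `u_s` are the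
event-triggered samples of the signals `ly ∘ ξ` and `lu ∘ ξ`. -/
noncomputable def sampledField (Ty Tu : TriggerParams) (ly : E → Vec a) (lu : E → Vec b)
    (f : Vec a → Vec b → E → E) (g : ℝ → E) (ξ : ℝ → E) (s : ℝ) : E :=
  f (held Ty (fun r => ly (ξ r)) s) (held Tu (fun r => lu (ξ r)) s) (ξ s) + g s

variable {Ty Tu : TriggerParams} {ly : E → Vec a} {lu : E → Vec b}
  {f : Vec a → Vec b → E → E} {g : ℝ → E}

theorem sampledField_congr (hy : 0 < Ty.τ) (hu : 0 < Tu.τ) (hly : Continuous ly)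
    (hlu : Continuous lu) {ξ η : ℝ → E} (hξ : Continuous ξ) (hη : Continuous η) {T : ℝ}
    (h : ∀ s ≤ T, ξ s = η s) {s : ℝ} (h0 : 0 ≤ s) (hs : s ≤ T) :
    sampledField Ty Tu ly lu f g ξ s = sampledField Ty Tu ly lu f g η s := by
  have h1 : held Ty (fun r => ly (ξ r)) s = held Ty (fun r => ly (η r)) s :=
    held_congr hy (hly.comp hξ) (hly.comp hη) (fun s hs => congrArg _ (h s hs)) h0 hs
  have h2 : held Tu (fun r => lu (ξ r)) s = held Tu (fun r => lu (η r)) s :=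
    held_congr hu (hlu.comp hξ) (hlu.comp hη) (fun s hs => congrArg _ (h s hs)) h0 hs
  rw [sampledField, sampledField, h s hs, h1, h2]

variable [NormedSpace ℝ E]

/-- `ξ` is continuous and solves the equation with event-triggered samples on `[0, T]`. -/
def SolvesUpTo (Ty Tu : TriggerParams) (ly : E → Vec a) (lu : E → Vec b)
    (f : Vec a → Vec b → E → E) (g : ℝ → E) (ξ : ℝ → E) (T : ℝ) : Prop :=
  Continuous ξ ∧ ∀ t, 0 ≤ t → t ≤ T →
    IntervalIntegrable (sampledField Ty Tu ly lu f g ξ) volume 0 t ∧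
      ξ t = ξ 0 + ∫ s in (0 : ℝ)..t, sampledField Ty Tu ly lu f g ξ s

/-- By causality of the samples, the equation on `[0, T]` ignores the path after `T`. This is what
allows continuation and gluing. -/
theorem SolvesUpTo.congr (hy : 0 < Ty.τ) (hu : 0 < Tu.τ) (hly : Continuous ly)
    (hlu : Continuous lu) {ξ η : ℝ → E} {T : ℝ} (hξ : SolvesUpTo Ty Tu ly lu f g ξ T)
    (hη : Continuous η) (h : ∀ s ≤ T, ξ s = η s) (hT : 0 ≤ T) :
    SolvesUpTo Ty Tu ly lu f g η T := by
  refine ⟨hη, fun t h0 ht => ?_⟩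
  have hc : ∀ s ∈ uIcc 0 t, sampledField Ty Tu ly lu f g ξ s = sampledField Ty Tu ly lu f g η s := by
    intro s hs
    rw [uIcc_of_le h0] at hs
    exact sampledField_congr hy hu hly hlu hξ.1 hη h hs.1 (hs.2.trans ht)
  obtain ⟨h1, h2⟩ := hξ.2 t h0 ht
  refine ⟨h1.congr fun s hs => hc s (uIoc_subset_uIcc hs), ?_⟩
  rw [← h t ht, ← h 0 hT, h2, intervalIntegral.integral_congr hc]

variable [CompleteSpace E] {K : NNReal} {h : ℝ}

/-- A solution up to `T` extends until a time `h` has passed or one of the two mechanisms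
triggers. -/
theorem SolvesUpTo.extend (hy : 0 < Ty.τ) (hu : 0 < Tu.τ) (hly : Continuous ly)
    (hlu : Continuous lu) (hf : ∀ y u, LipschitzWith K (f y u))
    (hg : ∀ s t, 0 ≤ s → s ≤ t → IntervalIntegrable g volume s t) (hh : 0 < h)
    (hK : K * h ≤ 1 / 2) {ξ : ℝ → E} {T : ℝ} (hT : 0 ≤ T)
    (hξ : SolvesUpTo Ty Tu ly lu f g ξ T) :
    ∃ (η : ℝ → E) (T' : ℝ), (∀ s ≤ T, ξ s = η s) ∧ T ≤ T' ∧ SolvesUpTo Ty Tu ly lu f g η T' ∧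
      ∀ j k, eventTime Ty (fun r => ly (ξ r)) j ≤ T → eventTime Tu (fun r => lu (ξ r)) k ≤ T →
        T + h ≤ T' ∨ ∃ j' k', j + k + 1 ≤ j' + k' ∧ eventTime Ty (fun r => ly (η r)) j' ≤ T' ∧
          eventTime Tu (fun r => lu (η r)) k' ≤ T' := by
  set yT := held Ty (fun r => ly (ξ r)) T with hyT
  set uT := held Tu (fun r => lu (ξ r)) T with huT
  obtain ⟨φ, hφc, hφT, hφ⟩ := exists_local_solution (hf yT uT) T (hg T · hT) hh hK (ξ T)
  set η : ℝ → E := fun s => if s ≤ T then ξ s else φ s with hη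
  have hηc : Continuous η :=
    Continuous.if_le hξ.1 hφc continuous_id continuous_const (by rintro x rfl; exact hφT.symm)
  have heq : ∀ s ≤ T, ξ s = η s := fun s hs => by simp [hη, hs]
  have heq' : ∀ s, T ≤ s → η s = φ s := fun s hs => by
    rcases hs.eq_or_lt with rfl | hs
    · simp [hη, hφT]
    · simp [hη, hs]
  have hyc : ∀ {ζ : ℝ → E}, Continuous ζ → Continuous fun r => ly (ζ r) := fun h => hly.comp h
  have huc : ∀ {ζ : ℝ → E}, Continuous ζ → Continuous fun r => lu (ζ r) := fun h => hlu.comp h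
  have hyeq : ∀ s ≤ T, ly (ξ s) = ly (η s) := fun s hs => by rw [heq s hs]
  have hueq : ∀ s ≤ T, lu (ξ s) = lu (η s) := fun s hs => by rw [heq s hs]
  have hwy := eventTime_dwell Ty (fun r => ly (η r))
  have hwu := eventTime_dwell Tu (fun r => lu (η r))
  obtain ⟨j₀, hj, hj'⟩ := exists_mem_interval_of_dwell hy
    (show eventTime Ty (fun r => ly (η r)) 0 = 0 from rfl) hwy hT
  obtain ⟨k₀, hk, hk'⟩ := exists_mem_interval_of_dwell hu
    (show eventTime Tu (fun r => lu (η r)) 0 = 0 from rfl) hwu hT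
  -- The frozen samples remain correct until the first subsequent event of `η`, so the extension is
  -- kept up to the minimum of that time and `T + h`.
  obtain ⟨T', hTT', hT'h, hT'y, hT'u, hT'⟩ : ∃ T' : ℝ, T ≤ T' ∧ T' ≤ T + h ∧
      (T' : EReal) ≤ eventTime Ty (fun r => ly (η r)) (j₀ + 1) ∧
      (T' : EReal) ≤ eventTime Tu (fun r => lu (η r)) (k₀ + 1) ∧
      (T' = T + h ∨ eventTime Ty (fun r => ly (η r)) (j₀ + 1) ≤ T' ∨
        eventTime Tu (fun r => lu (η r)) (k₀ + 1) ≤ T') := by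
    set m : EReal := min ((T + h : ℝ) : EReal) (min (eventTime Ty (fun r => ly (η r)) (j₀ + 1))
      (eventTime Tu (fun r => lu (η r)) (k₀ + 1))) with hm
    have hTm : (T : EReal) ≤ m :=
      le_min (by exact_mod_cast (by linarith : T ≤ T + h)) (le_min hj'.le hk'.le)
    have hmt : m ≠ ⊤ := ne_top_of_le_ne_top (EReal.coe_ne_top (T + h)) (min_le_left _ _)
    have hmb : m ≠ ⊥ := ne_bot_of_le_ne_bot (EReal.coe_ne_bot T) hTm
    have hme : ((m.toReal : ℝ) : EReal) = m := EReal.coe_toReal hmt hmb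
    refine ⟨m.toReal, ?_, ?_, ?_, ?_, ?_⟩
    · rw [← EReal.coe_le_coe_iff, hme]; exact hTm
    · rw [← EReal.coe_le_coe_iff, hme]; exact min_le_left _ _
    · rw [hme]; exact (min_le_right _ _).trans (min_le_left _ _)
    · rw [hme]; exact (min_le_right _ _).trans (min_le_right _ _)
    · rw [hme]
      rcases min_choice ((T + h : ℝ) : EReal) (min (eventTime Ty (fun r => ly (η r)) (j₀ + 1))
        (eventTime Tu (fun r => lu (η r)) (k₀ + 1))) with h1 | h1
      · left
        rw [← EReal.coe_eq_coe_iff, hme, hm, h1]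
      · right
        rw [hm, h1]
        rcases min_choice (eventTime Ty (fun r => ly (η r)) (j₀ + 1))
          (eventTime Tu (fun r => lu (η r)) (k₀ + 1)) with h2 | h2
        · exact Or.inl h2.ge
        · exact Or.inr h2.ge
  have hTle : ∀ {s : ℝ}, T ≤ s → (T : EReal) ≤ s := fun hs => by exact_mod_cast hs
  have hfield : ∀ s, T ≤ s → s < T' →
      sampledField Ty Tu ly lu f g η s = f yT uT (φ s) + g s := by
    intro s hs hs'
    have hs'' : (s : EReal) < T' := by exact_mod_cast hs'
    rw [sampledField, heq' s hs, hyT, huT,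
      held_congr hy (hyc hξ.1) (hyc hηc) hyeq hT le_rfl,
      held_congr hu (huc hξ.1) (huc hηc) hueq hT le_rfl,
      held_eq hy (hj.trans (hTle hs)) (hs''.trans_le hT'y), held_eq hy hj hj',
      held_eq hu (hk.trans (hTle hs)) (hs''.trans_le hT'u), held_eq hu hk hk']
  have hold := hξ.congr hy hu hly hlu hηc heq hT
  refine ⟨η, T', heq, hTT', ⟨hηc, fun t h0 ht => ?_⟩, fun j k hjT hkT => ?_⟩
  · rcases le_total t T with htT | htT
    · exact hold.2 t h0 htT
    · obtain ⟨h1, h2⟩ := hold.2 T hT le_rfl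
      have hcont : IntervalIntegrable (fun s => f yT uT (φ s) + g s) volume T t :=
        (((hf yT uT).continuous.comp hφc).intervalIntegrable _ _).add (hg T t hT htT)
      have hae : ∀ᵐ s, s ∈ uIoc T t →
          f yT uT (φ s) + g s = sampledField Ty Tu ly lu f g η s := by
        -- At `T'` itself a sample may already have been updated; a single point does not affect the
        -- integral.
        have hne : ∀ᵐ s : ℝ, s ≠ T' := by simp [ae_iff]
        filter_upwards [hne] with s hs hst
        rw [uIoc_of_le htT] at hst
        exact (hfield s hst.1.le (lt_of_le_of_ne (hst.2.trans ht) hs)).symm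
      have h3 : IntervalIntegrable (sampledField Ty Tu ly lu f g η) volume T t :=
        hcont.congr_ae ((ae_restrict_iff' measurableSet_uIoc).2 hae)
      refine ⟨h1.trans h3, ?_⟩
      rw [← intervalIntegral.integral_add_adjacent_intervals h1 h3, ← add_assoc, ← h2,
        heq' t htT, hφ t ⟨htT, ht.trans hT'h⟩, heq T le_rfl,
        intervalIntegral.integral_congr_ae hae]
  · rcases hT' with hT' | hT'
    · exact Or.inl hT'.ge
    · right
      -- The counts `j`, `k` refer to events of `ξ` up to `T`, which are also events of `η`; so they
      -- do not exceed `j₀`, `k₀`, and the event at `T'` raises the total.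
      have hjj : j < j₀ + 1 := by
        refine (monotone_of_dwell hy hwy).reflect_lt (lt_of_le_of_lt ?_ hj')
        rwa [eventTime_eq_of_le hy (hyc hξ.1) (hyc hηc) hyeq hjT]
      have hkk : k < k₀ + 1 := by
        refine (monotone_of_dwell hu hwu).reflect_lt (lt_of_le_of_lt ?_ hk')
        rwa [eventTime_eq_of_le hu (huc hξ.1) (huc hηc) hueq hkT]
      rcases hT' with hT' | hT'
      · exact ⟨j₀ + 1, k₀, by omega, hT', hk.trans (hTle hTT')⟩
      · exact ⟨j₀, k₀ + 1, by omega, hj.trans (hTle hTT'), hT'⟩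

theorem SolvesUpTo.extend_by (hy : 0 < Ty.τ) (hu : 0 < Tu.τ) (hly : Continuous ly)
    (hlu : Continuous lu) (hf : ∀ y u, LipschitzWith K (f y u))
    (hg : ∀ s t, 0 ≤ s → s ≤ t → IntervalIntegrable g volume s t) (hh : 0 < h)
    (hK : K * h ≤ 1 / 2) {ξ : ℝ → E} {T : ℝ} (hT : 0 ≤ T)
    (hξ : SolvesUpTo Ty Tu ly lu f g ξ T) :
    ∃ η : ℝ → E, (∀ s ≤ T, ξ s = η s) ∧ SolvesUpTo Ty Tu ly lu f g η (T + h) := by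
  have key : ∀ m : ℕ, ∃ (η : ℝ → E) (T' : ℝ), (∀ s ≤ T, ξ s = η s) ∧ T ≤ T' ∧
      SolvesUpTo Ty Tu ly lu f g η T' ∧ (T + h ≤ T' ∨ ∃ j k, m ≤ j + k ∧
        eventTime Ty (fun r => ly (η r)) j ≤ T' ∧ eventTime Tu (fun r => lu (η r)) k ≤ T') := by
    intro m
    induction m with
    | zero =>
      exact ⟨ξ, T, fun _ _ => rfl, le_rfl, hξ, Or.inr ⟨0, 0, le_rfl, by simpa [eventTime] using hT,
        by simpa [eventTime] using hT⟩⟩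
    | succ m ih =>
      obtain ⟨η, T', h1, h2, h3, h4 | ⟨j, k, hjk, hj, hk⟩⟩ := ih
      · exact ⟨η, T', h1, h2, h3, Or.inl h4⟩
      · obtain ⟨ζ, T'', h5, h6, h7, h8⟩ :=
          h3.extend hy hu hly hlu hf hg hh hK (hT.trans h2)
        refine ⟨ζ, T'', fun s hs => (h1 s hs).trans (h5 s (hs.trans h2)), h2.trans h6, h7, ?_⟩
        rcases h8 j k hj hk with h8 | ⟨j', k', h8, h9, h10⟩
        · left; linarith
        · exact Or.inr ⟨j', k', by omega, h9, h10⟩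
  -- After `N₁ + N₂` events, one channel has had its share `N₁` or `N₂`, and its waiting times alone
  -- exceed `T + h`.
  obtain ⟨N₁, hN₁⟩ := exists_nat_gt ((T + h) / Ty.τ)
  obtain ⟨N₂, hN₂⟩ := exists_nat_gt ((T + h) / Tu.τ)
  rw [div_lt_iff₀ hy] at hN₁
  rw [div_lt_iff₀ hu] at hN₂
  obtain ⟨η, T', h1, h2, h3, h4⟩ := key (N₁ + N₂)
  have h5 : T + h ≤ T' := by
    rcases h4 with h4 | ⟨j, k, hjk, hj, hk⟩
    · exact h4
    · have hj' := (mul_le_of_dwell rfl (eventTime_dwell _ _) j).trans hj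
      have hk' := (mul_le_of_dwell rfl (eventTime_dwell _ _) k).trans hk
      rw [EReal.coe_le_coe_iff] at hj' hk'
      rcases (by omega : N₁ ≤ j ∨ N₂ ≤ k) with h6 | h6
      · have : (N₁ : ℝ) * Ty.τ ≤ j * Ty.τ := by gcongr
        linarith
      · have : (N₂ : ℝ) * Tu.τ ≤ k * Tu.τ := by gcongr
        linarith
  exact ⟨η, h1, h3.1, fun t h0 ht => h3.2 t h0 (ht.trans h5)⟩

/-- Global existence for `ξ̇ = f (y_s, u_s, ξ) + g` with event-triggered samples. -/
theorem exists_global_solution (hy : 0 < Ty.τ) (hu : 0 < Tu.τ) (hly : Continuous ly)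
    (hlu : Continuous lu) (hf : ∀ y u, LipschitzWith K (f y u))
    (hg : ∀ s t, 0 ≤ s → s ≤ t → IntervalIntegrable g volume s t) (ξ₀ : E) :
    ∃ ξ : ℝ → E, ξ 0 = ξ₀ ∧ ∀ T, SolvesUpTo Ty Tu ly lu f g ξ T := by
  obtain ⟨h, hh, hK⟩ : ∃ h : ℝ, 0 < h ∧ K * h ≤ 1 / 2 := by
    refine ⟨1 / (2 * (K + 1)), by positivity, ?_⟩
    rw [mul_one_div, div_le_div_iff₀ (by positivity) (by norm_num)]
    linarith [K.coe_nonneg]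
  have hstep : ∀ n : ℕ, ∀ p : {ξ : ℝ → E // SolvesUpTo Ty Tu ly lu f g ξ (n * h)},
      ∃ q : {ξ : ℝ → E // SolvesUpTo Ty Tu ly lu f g ξ ((n + 1 : ℕ) * h)},
        ∀ s ≤ n * h, p.1 s = q.1 s := by
    intro n p
    obtain ⟨η, h1, h2⟩ := p.2.extend_by hy hu hly hlu hf hg hh hK (by positivity)
    exact ⟨⟨η, by push_cast; rwa [add_one_mul]⟩, h1⟩
  choose next hnext using hstep
  let init : {ξ : ℝ → E // SolvesUpTo Ty Tu ly lu f g ξ ((0 : ℕ) * h)} :=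
    ⟨fun _ => ξ₀, continuous_const, fun t h0 ht => by
      have : t = 0 := le_antisymm (by simpa using ht) h0
      subst this
      simp⟩
  let seq : ∀ n : ℕ, {ξ : ℝ → E // SolvesUpTo Ty Tu ly lu f g ξ (n * h)} :=
    fun n => Nat.rec init next n
  have hseq : ∀ m n : ℕ, m ≤ n → ∀ s ≤ m * h, (seq m).1 s = (seq n).1 s := by
    intro m n hmn
    induction n, hmn using Nat.le_induction with
    | base => exact fun _ _ => rfl
    | succ n hmn ih =>
      intro s hs
      rw [ih s hs]
      refine hnext n (seq n) s (hs.trans ?_)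
      gcongr
  -- The strict inequality makes the glued path coincide with a single piece near `s`, which gives
  -- continuity.
  have hidx : ∀ s : ℝ, ∃ n : ℕ, s < n * h := fun s => by
    obtain ⟨n, hn⟩ := exists_nat_gt (s / h)
    exact ⟨n, (div_lt_iff₀ hh).1 hn⟩
  choose N hN using hidx
  set ξ : ℝ → E := fun s => (seq (N s)).1 s with hξ
  have hξeq : ∀ n : ℕ, ∀ s ≤ n * h, (seq n).1 s = ξ s := by
    intro n s hs
    rcases le_total n (N s) with h1 | h1
    · exact hseq _ _ h1 s hs
    · exact (hseq _ _ h1 s (hN s).le).symm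
  have hξc : Continuous ξ := by
    refine continuous_iff_continuousAt.2 fun s => ?_
    refine (seq (N s)).2.1.continuousAt.congr ?_
    filter_upwards [Iio_mem_nhds (hN s)] with r hr
    exact hξeq _ r hr.le
  have hsol : ∀ n : ℕ, SolvesUpTo Ty Tu ly lu f g ξ (n * h) := fun n =>
    (seq n).2.congr hy hu hly hlu hξc (hξeq n) (by positivity)
  refine ⟨ξ, ?_, fun T => ⟨hξc, fun t h0 _ => (hsol (N t)).2 t h0 (hN t).le⟩⟩
  exact (hξeq 0 0 (by simp)).symm

end Global

/-! ### Lipschitz estimates for the closed loop -/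

section Estimates

section Lipschitz

variable {X : Type*} [PseudoEMetricSpace X] {m n : ℕ}

theorem exists_lipschitz_add {f g : X → Vec n} (hf : ∃ K, LipschitzWith K f)
    (hg : ∃ K, LipschitzWith K g) : ∃ K, LipschitzWith K fun x => f x + g x :=
  ⟨_, hf.choose_spec.add hg.choose_spec⟩

theorem exists_lipschitz_sub {f g : X → Vec n} (hf : ∃ K, LipschitzWith K f)
    (hg : ∃ K, LipschitzWith K g) : ∃ K, LipschitzWith K fun x => f x - g x :=
  ⟨_, hf.choose_spec.sub hg.choose_spec⟩

theorem exists_lipschitz_comp {Y Z : Type*} [PseudoEMetricSpace Y] [PseudoEMetricSpace Z]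
    {g : Y → Z} {f : X → Y} (hg : ∃ K, LipschitzWith K g) (hf : ∃ K, LipschitzWith K f) :
    ∃ K, LipschitzWith K fun x => g (f x) :=
  ⟨_, hg.choose_spec.comp hf.choose_spec⟩

theorem exists_lipschitz_act (M : Matrix (Fin m) (Fin n) ℝ) {f : X → Vec n}
    (hf : ∃ K, LipschitzWith K f) : ∃ K, LipschitzWith K fun x => act M (f x) :=
  exists_lipschitz_comp ⟨_, (LinearMap.toContinuousLinearMap (Matrix.toEuclideanLin M)).lipschitz⟩
    hf

theorem exists_lipschitz_prodMk {Y Z : Type*} [PseudoEMetricSpace Y] [PseudoEMetricSpace Z]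
    {f : X → Y} {g : X → Z} (hf : ∃ K, LipschitzWith K f) (hg : ∃ K, LipschitzWith K g) :
    ∃ K, LipschitzWith K fun x => (f x, g x) :=
  ⟨_, hf.choose_spec.prodMk hg.choose_spec⟩

theorem exists_lipschitz_fst {Y Z : Type*} [PseudoEMetricSpace Y] [PseudoEMetricSpace Z]
    {f : X → Y × Z} (hf : ∃ K, LipschitzWith K f) : ∃ K, LipschitzWith K fun x => (f x).1 :=
  exists_lipschitz_comp ⟨_, LipschitzWith.prod_fst⟩ hf

theorem exists_lipschitz_snd {Y Z : Type*} [PseudoEMetricSpace Y] [PseudoEMetricSpace Z]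
    {f : X → Y × Z} (hf : ∃ K, LipschitzWith K f) : ∃ K, LipschitzWith K fun x => (f x).2 :=
  exists_lipschitz_comp ⟨_, LipschitzWith.prod_snd⟩ hf

end Lipschitz

variable {nx nu ny nq np nw : ℕ}

/-- The right-hand side of plant and observer as a function of `(x, x̂)`, of the sampled signals
`(y_s, x̂_s)` and of `w`. -/
noncomputable def jointField (S : Plant nx nu ny nq np nw) (G : Gains nx nu ny nq np)
    (q : (Vec nx × Vec nx) × (Vec ny × Vec nx) × Vec nw) : Vec nx × Vec nx :=
  (plantField S q.1.1 (feedback S G q.2.1.2) q.2.2,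
    observerField S G q.1.2 (feedback S G q.2.1.2) q.2.1.1)

variable {S : Plant nx nu ny nq np nw} (G : Gains nx nu ny nq np)

theorem exists_lipschitz_jointField (hp : ∃ ℓ : NNReal, LipschitzWith ℓ S.p) :
    ∃ K, LipschitzWith K (jointField S G) := by
  let X := (Vec nx × Vec nx) × (Vec ny × Vec nx) × Vec nw
  have hid : ∃ K, LipschitzWith K fun q : X => q := ⟨1, LipschitzWith.id⟩
  have hx := exists_lipschitz_fst (exists_lipschitz_fst hid)
  have hxh := exists_lipschitz_snd (exists_lipschitz_fst hid)
  have hys := exists_lipschitz_fst (exists_lipschitz_fst (exists_lipschitz_snd hid))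
  have hxs := exists_lipschitz_snd (exists_lipschitz_fst (exists_lipschitz_snd hid))
  have hw := exists_lipschitz_snd (exists_lipschitz_snd hid)
  have hu : ∃ K, LipschitzWith K fun q : X => feedback S G q.2.1.2 :=
    exists_lipschitz_add (exists_lipschitz_act _ hxs)
      (exists_lipschitz_act _ (exists_lipschitz_comp hp (exists_lipschitz_act _ hxs)))
  have hd : ∃ K, LipschitzWith K fun q : X =>
      predictedOutput S q.1.2 (feedback S G q.2.1.2) - q.2.1.1 :=
    exists_lipschitz_sub
      (exists_lipschitz_add (exists_lipschitz_act _ hxh) (exists_lipschitz_act _ hu)) hys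
  refine exists_lipschitz_prodMk ?_ ?_
  · exact exists_lipschitz_add (exists_lipschitz_add (exists_lipschitz_add
      (exists_lipschitz_act _ hx) (exists_lipschitz_act _ hu))
      (exists_lipschitz_act _ (exists_lipschitz_comp hp (exists_lipschitz_act _ hx))))
      (exists_lipschitz_act _ hw)
  · exact exists_lipschitz_add (exists_lipschitz_add (exists_lipschitz_add
      (exists_lipschitz_act _ hxh) (exists_lipschitz_act _ hu))
      (exists_lipschitz_act _ (exists_lipschitz_comp hp
        (exists_lipschitz_add (exists_lipschitz_act _ hxh) (exists_lipschitz_act _ hd)))))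
      (exists_lipschitz_act _ hd)

theorem jointField_zero (hp0 : S.p 0 = 0) : jointField S G 0 = 0 := by
  simp [jointField, plantField, observerField, feedback, predictedOutput, hp0]

/-- The disturbance enters additively, so it can serve as the merely integrable term `g` in the
existence theorem. -/
theorem jointField_eq_add (ξ : Vec nx × Vec nx) (s : Vec ny × Vec nx) (w : Vec nw) :
    jointField S G (ξ, s, w) = jointField S G (ξ, s, 0) + (act S.Ew w, 0) := by
  simp [jointField, plantField]

/-- The state `z = (x, x - x̂)` as a linear function of `(x, x̂)`. -/
noncomputable def toState (n : ℕ) : Vec n × Vec n →L[ℝ] State n :=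
  LinearMap.toContinuousLinearMap
    { toFun := fun ξ => stack ξ.1 (ξ.1 - ξ.2)
      map_add' := fun ξ η => by
        ext i; cases i <;> simp [stack]; ring
      map_smul' := fun c ξ => by
        ext i; cases i <;> simp [stack]; ring }

/-- The pair `(x, x̂)` as a linear function of `z = (x, x - x̂)`. -/
noncomputable def ofState (n : ℕ) : State n →L[ℝ] Vec n × Vec n :=
  LinearMap.toContinuousLinearMap
    { toFun := fun z => (fstBlock z, fstBlock z - sndBlock z)
      map_add' := fun z z' => by
        ext i <;> simp [fstBlock, sndBlock]; ring
      map_smul' := fun c z => by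
        ext i <;> simp [fstBlock, sndBlock]; ring }

theorem toState_apply {n : ℕ} (ξ : Vec n × Vec n) : toState n ξ = stack ξ.1 (ξ.1 - ξ.2) := rfl

theorem ofState_apply {n : ℕ} (z : State n) :
    ofState n z = (fstBlock z, fstBlock z - sndBlock z) := rfl

theorem ofState_toState {n : ℕ} (ξ : Vec n × Vec n) : ofState n (toState n ξ) = ξ := by
  rw [ofState_apply, toState_apply]
  ext i <;> simp [fstBlock, sndBlock, stack]

theorem toState_ofState {n : ℕ} (z : State n) : toState n (ofState n z) = z := by
  rw [ofState_apply, toState_apply]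
  ext i; cases i <;> simp [fstBlock, sndBlock, stack]

/-- Here `D = 0` and `F_w = 0` matter: the monitored output is a function of the state alone, hence
continuous in time, without jumps at control updates. -/
theorem output_eq (hD : S.D = 0) (hFw : S.Fw = 0) (x : Vec nx) (u : Vec nu) (w : Vec nw) :
    output S x u w = act S.C x := by
  simp [output, hD, hFw, act]

/-- The continuous-time loop is the joint field fed with exact samples, so sampling is a
perturbation of its arguments. -/
theorem closedLoopField_eq (hD : S.D = 0) (hFw : S.Fw = 0) (z : State nx) :
    closedLoopField S G z 0 = toState nx
      (jointField S G (ofState nx z, (act S.C (ofState nx z).1, (ofState nx z).2), 0)) := by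
  simp only [closedLoopField, output_eq hD hFw]
  rfl

/-- Both bounds are Lipschitz estimates: one compares with the equilibrium `0`, the other compares
two values of `jointField` at the same `ξ`. -/
theorem exists_closedLoop_bounds (hD : S.D = 0) (hFw : S.Fw = 0) (hp0 : S.p 0 = 0)
    (hp : ∃ ℓ : NNReal, LipschitzWith ℓ S.p) :
    ∃ κ : ℝ, 0 < κ ∧ Continuous (fun z => closedLoopField S G z 0) ∧
      (∀ z, ‖closedLoopField S G z 0‖ ≤ κ * ‖z‖) ∧
      ∀ ξ ys xs w, ‖toState nx (jointField S G (ξ, (ys, xs), w))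
          - closedLoopField S G (toState nx ξ) 0‖
        ≤ κ * (‖ys - act S.C ξ.1‖ + ‖xs - ξ.2‖ + ‖w‖) := by
  obtain ⟨K, hK⟩ := exists_lipschitz_jointField G hp
  have hT : ∃ K, LipschitzWith K (toState nx) := ⟨_, (toState nx).lipschitz⟩
  have hU : ∃ K, LipschitzWith K (ofState nx) := ⟨_, (ofState nx).lipschitz⟩
  obtain ⟨K₁, hK₁⟩ : ∃ K, LipschitzWith K fun z => closedLoopField S G z 0 := by
    simp only [closedLoopField_eq G hD hFw]
    exact exists_lipschitz_comp hT (exists_lipschitz_comp ⟨K, hK⟩ (exists_lipschitz_prodMk hU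
      (exists_lipschitz_prodMk (exists_lipschitz_prodMk
        (exists_lipschitz_act _ (exists_lipschitz_fst hU)) (exists_lipschitz_snd hU))
        ⟨0, LipschitzWith.const (0 : Vec nw)⟩)))
  obtain ⟨K₂, hK₂⟩ := exists_lipschitz_comp hT ⟨K, hK⟩
  refine ⟨K₁ + K₂ + 1, by positivity, hK₁.continuous, fun z => ?_, fun ξ ys xs w => ?_⟩
  · have h0 : closedLoopField S G 0 0 = 0 := by
      rw [closedLoopField_eq G hD hFw]
      have : ((ofState nx 0, (act S.C (ofState nx 0).1, (ofState nx 0).2), 0) :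
          (Vec nx × Vec nx) × (Vec ny × Vec nx) × Vec nw) = 0 := by simp
      rw [this, jointField_zero G hp0, map_zero]
    have h1 := hK₁.dist_le_mul z 0
    rw [h0, dist_zero_right, dist_zero_right] at h1
    refine h1.trans (mul_le_mul_of_nonneg_right ?_ (norm_nonneg _))
    linarith [K₂.coe_nonneg]
  · rw [closedLoopField_eq G hD hFw, ofState_toState, ← dist_eq_norm]
    refine (hK₂.dist_le_mul _ _).trans ?_
    have h2 : dist (ξ, (ys, xs), w) (ξ, (act S.C ξ.1, ξ.2), 0) ≤
        ‖ys - act S.C ξ.1‖ + ‖xs - ξ.2‖ + ‖w‖ := by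
      have h3 := norm_nonneg (ys - act S.C ξ.1)
      have h4 := norm_nonneg (xs - ξ.2)
      have h5 := norm_nonneg w
      simp only [Prod.dist_eq, dist_self]
      rw [dist_eq_norm, dist_eq_norm, dist_zero_right]
      refine max_le (by positivity) (max_le (max_le ?_ ?_) ?_) <;> linarith
    refine mul_le_mul ?_ h2 dist_nonneg (by positivity)
    linarith [K₁.coe_nonneg]

end Estimates

/-! ### Pointwise bounds for the sampling errors -/

section SamplingError

variable {Z : Type*} [NormedAddCommGroup Z] [NormedSpace ℝ Z]

/-- The parameters of a mechanism are small relative to a bound `c` for the growth of the state, a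
bound `ℓ` for the gain of the signal, the admissible relative error `η` and the offset `m`. -/
structure TriggerParams.IsFine (T : TriggerParams) (c ℓ η m : ℝ) : Prop where
  τ_pos : 0 < T.τ
  σ_nonneg : 0 ≤ T.σ
  growth : c * T.τ ≤ 1 / 2
  gain : ℓ * (c * T.τ) * 2 ≤ η / 2
  σ_le : T.σ * ℓ ≤ η / 2
  ε_le : T.ε ≤ η / 2 * m

/-- Sampling intervals are closed on the left and open on the right. This right-constancy lets the
error bound continue past a given time. -/
theorem IsSampled.eventually_eq {n : ℕ} {T : TriggerParams} (hT : 0 < T.τ) {ξ ξs : ℝ → Vec n}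
    {tk : ℕ → EReal} (htk : IsTriggerSequence T ξ tk) (hs : IsSampled tk ξ ξs) {t : ℝ}
    (ht : 0 ≤ t) : ∀ᶠ s in 𝓝[≥] t, ξs s = ξs t := by
  obtain ⟨k, hk, hk'⟩ := exists_mem_interval_of_dwell hT htk.zero htk.wait ht
  have h1 : ∀ᶠ s : ℝ in 𝓝 t, (s : EReal) < tk (k + 1) :=
    continuous_coe_real_ereal.continuousAt.eventually (gt_mem_nhds hk')
  filter_upwards [self_mem_nhdsWithin, mem_nhdsWithin_of_mem_nhds h1] with s hts hs'
  rw [hs k s (hk.trans (by exact_mod_cast hts)) hs', hs k t hk hk']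

/-- If the state grows slowly up to time `t`, then the sampling error at time `t` is small. -/
theorem sampling_error_le {n : ℕ} {T : TriggerParams} {c ℓ η m : ℝ} (hT : T.IsFine c ℓ η m)
    (hc : 0 ≤ c) (hℓ : 0 ≤ ℓ) {z : ℝ → Z} (hz : ContinuousOn z (Ici 0)) {l : Z →L[ℝ] Vec n}
    (hl : ∀ z, ‖l z‖ ≤ ℓ * ‖z‖) (hm : 0 ≤ m) {ξs : ℝ → Vec n} {tk : ℕ → EReal}
    (htk : IsTriggerSequence T (fun t => l (z t)) tk) (hs : IsSampled tk (fun t => l (z t)) ξs)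
    {t : ℝ} (ht : 0 ≤ t)
    (hinc : ∀ a M, 0 ≤ a → a ≤ t → (∀ s ∈ Icc a t, ‖z s‖ + m ≤ M) →
      ∀ s ∈ Icc a t, ‖z t - z s‖ ≤ c * (t - s) * M) :
    ‖ξs t - l (z t)‖ ≤ η / 2 * (‖z t‖ + m) := by
  obtain ⟨k, hk, hk'⟩ := exists_mem_interval_of_dwell hT.τ_pos htk.zero htk.wait ht
  rw [hs k t hk hk']
  obtain ⟨h0, he, ha⟩ := eq_coe_toReal_of_dwell hT.τ_pos htk.zero htk.wait hk
  set a := (tk k).toReal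
  -- After the waiting time the rule bounds the error directly. Before that, the error is the motion
  -- since `a`, measured against the maximum `M` of `‖z‖ + m`.
  rcases le_or_gt (a + T.τ) t with h1 | h1
  · have h2 := htk.quiet k t (by rw [← he]; exact_mod_cast h1) hk'
    have h3 := mul_le_mul_of_nonneg_left (hl (z t)) hT.σ_nonneg
    have h4 := mul_le_mul_of_nonneg_right hT.σ_le (norm_nonneg (z t))
    have h5 := hT.ε_le
    change ‖l (z a) - l (z t)‖ ≤ T.σ * ‖l (z t)‖ + T.ε at h2
    linarith
  · obtain ⟨r, hr, hmax⟩ := isCompact_Icc.exists_isMaxOn (nonempty_Icc.2 ha)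
      (hz.mono fun s hs => h0.trans hs.1 : ContinuousOn z (Icc a t)).norm
    have hM : ∀ s ∈ Icc a t, ‖z s‖ + m ≤ ‖z r‖ + m := fun s hs => by
      have : ‖z s‖ ≤ ‖z r‖ := hmax hs
      linarith
    set M := ‖z r‖ + m with hMdef
    have hM0 : 0 ≤ M := by positivity
    have hinc' : ∀ s ∈ Icc a t, ‖z t - z s‖ ≤ c * T.τ * M := fun s hs => by
      refine (hinc a M h0 ha hM s hs).trans ?_
      have : t - s ≤ T.τ := by linarith [hs.1]
      gcongr
    have h2 := hinc' r hr
    have h3 := hT.growth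
    have h4 : ‖z r‖ ≤ ‖z t‖ + ‖z t - z r‖ := by
      -- The maximum exceeds the value at `t` by at most `M / 2`, whence `M ≤ 2 (‖z t‖ + m)`.
      have := norm_sub_le (z t) (z t - z r)
      simpa using this
    have h5 : c * T.τ * M ≤ 1 / 2 * M := by gcongr
    have h6 : M ≤ 2 * (‖z t‖ + m) := by linarith
    have h7 := hinc' a ⟨le_rfl, ha⟩
    have hτ := hT.τ_pos
    calc ‖l (z a) - l (z t)‖ = ‖l (z t - z a)‖ := by rw [map_sub, norm_sub_rev]
      _ ≤ ℓ * ‖z t - z a‖ := hl _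
      _ ≤ ℓ * (c * T.τ * (2 * (‖z t‖ + m))) := by
          gcongr
          exact h7.trans (by gcongr)
      _ = ℓ * (c * T.τ) * 2 * (‖z t‖ + m) := by ring
      _ ≤ η / 2 * (‖z t‖ + m) := by
          have := hT.gain
          gcongr

theorem continuousOn_of_eq_integral {z v : ℝ → Z}
    (hz : ∀ t, 0 ≤ t → IntervalIntegrable v volume 0 t ∧ z t = z 0 + ∫ s in (0 : ℝ)..t, v s) :
    ContinuousOn z (Ici 0) := by
  intro t ht
  have ht' : (0 : ℝ) ≤ t + 1 := by linarith [mem_Ici.1 ht]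
  have h1 : ContinuousOn (fun t => z 0 + ∫ s in (0 : ℝ)..t, v s) (Icc 0 (t + 1)) := by
    refine continuousOn_const.add ?_
    have := intervalIntegral.continuousOn_primitive_interval (μ := volume) (f := v)
      (a := 0) (b := t + 1) ?_
    · rwa [uIcc_of_le ht'] at this
    · rw [uIcc_of_le ht', integrableOn_Icc_iff_integrableOn_Ioc]
      exact (intervalIntegrable_iff_integrableOn_Ioc_of_le ht').1 (hz _ ht').1
  have h2 : ContinuousWithinAt z (Icc 0 (t + 1)) t :=
    (h1 t ⟨ht, by linarith⟩).congr (fun s hs => (hz s hs.1).2) (hz t ht).2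
  refine h2.mono_of_mem_nhdsWithin ?_
  rw [← Ici_inter_Iic]
  exact inter_mem self_mem_nhdsWithin
    (mem_nhdsWithin_of_mem_nhds (Iic_mem_nhds (by linarith)))

theorem sub_eq_integral {z v : ℝ → Z}
    (hz : ∀ t, 0 ≤ t → IntervalIntegrable v volume 0 t ∧ z t = z 0 + ∫ s in (0 : ℝ)..t, v s)
    {s t : ℝ} (hs : 0 ≤ s) (ht : 0 ≤ t) :
    IntervalIntegrable v volume s t ∧ z t - z s = ∫ r in s..t, v r := by
  refine ⟨(hz s hs).1.symm.trans (hz t ht).1, ?_⟩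
  rw [(hz t ht).2, (hz s hs).2, ← intervalIntegral.integral_interval_sub_left (hz t ht).1
    (hz s hs).1]
  abel

/-- Along the event-triggered loop, both sampling errors stay small relative to the state. -/
theorem sampling_errors_le {a b : ℕ} {z v : ℝ → Z}
    (hz : ∀ t, 0 ≤ t → IntervalIntegrable v volume 0 t ∧ z t = z 0 + ∫ s in (0 : ℝ)..t, v s)
    {f : Z → Z} {κ : ℝ} (hκ : 0 < κ) (hf : ∀ z, ‖f z‖ ≤ κ * ‖z‖)
    {ly : Z →L[ℝ] Vec a} {lu : Z →L[ℝ] Vec b} {ℓ : ℝ} (hℓ : 0 ≤ ℓ)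
    (hly : ∀ z, ‖ly z‖ ≤ ℓ * ‖z‖) (hlu : ∀ z, ‖lu z‖ ≤ ℓ * ‖z‖)
    {ω m η : ℝ} (hm : 0 < m) (hωm : ω ≤ m) (hη : 0 < η) (hη1 : η ≤ 1)
    {Ty Tu : TriggerParams} (hTy : Ty.IsFine (3 * κ) ℓ η m) (hTu : Tu.IsFine (3 * κ) ℓ η m)
    {ys : ℝ → Vec a} {us : ℝ → Vec b} {ty tu : ℕ → EReal}
    (hty : IsTriggerSequence Ty (fun t => ly (z t)) ty) (hys : IsSampled ty (fun t => ly (z t)) ys)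
    (htu : IsTriggerSequence Tu (fun t => lu (z t)) tu) (hus : IsSampled tu (fun t => lu (z t)) us)
    (hv : ∀ᵐ t : ℝ, 0 ≤ t →
      ‖v t - f (z t)‖ ≤ κ * (‖ys t - ly (z t)‖ + ‖us t - lu (z t)‖ + ω)) :
    ∀ t, 0 ≤ t → ‖ys t - ly (z t)‖ ≤ η * (‖z t‖ + m) ∧ ‖us t - lu (z t)‖ ≤ η * (‖z t‖ + m) := by
  have hzc := continuousOn_of_eq_integral hz
  set good : ℝ → Prop := fun t =>
    ‖ys t - ly (z t)‖ ≤ η * (‖z t‖ + m) ∧ ‖us t - lu (z t)‖ ≤ η * (‖z t‖ + m) with hgood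
  by_contra hcon
  push Not at hcon
  obtain ⟨t₁, ht₁, hbad⟩ := hcon
  set B : Set ℝ := {t | 0 ≤ t ∧ ¬ good t} with hB
  have hBne : B.Nonempty := ⟨t₁, ht₁, fun h => absurd (hbad h.1) (not_lt.2 h.2)⟩
  have hBb : BddBelow B := ⟨0, fun t ht => ht.1⟩
  set t := sInf B with ht
  have ht0 : 0 ≤ t := le_csInf hBne fun s hs => hs.1
  have hlt : ∀ s, 0 ≤ s → s < t → good s := fun s hs hst => by
    by_contra h
    exact absurd (csInf_le hBb ⟨hs, h⟩) (not_le.2 hst)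
  -- The error bounds strictly before `t` suffice, since the displacement is an integral. With `η ≤
  -- 1` and `ω ≤ m` the velocity is at most `κ ‖z‖ + κ (2 (‖z‖ + m) + m) = 3 κ (‖z‖ + m)`.
  have hinc : ∀ a M, 0 ≤ a → a ≤ t → (∀ s ∈ Icc a t, ‖z s‖ + m ≤ M) →
      ∀ s ∈ Icc a t, ‖z t - z s‖ ≤ 3 * κ * (t - s) * M := by
    intro a M ha hat hM s hs
    rw [(sub_eq_integral hz (ha.trans hs.1) ht0).2]
    have h1 : ‖∫ r in s..t, v r‖ ≤ 3 * κ * M * |t - s| := by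
      refine intervalIntegral.norm_integral_le_of_norm_le_const_ae ?_
      have hne : ∀ᵐ r : ℝ, r ≠ t := by simp [ae_iff]
      filter_upwards [hv, hne] with r hr hrt hrs
      rw [uIoc_of_le hs.2] at hrs
      have hr0 : 0 ≤ r := ha.trans (hs.1.trans hrs.1.le)
      have h2 := hr hr0
      obtain ⟨h3, h4⟩ := hlt r hr0 (lt_of_le_of_ne hrs.2 hrt)
      have h5 := hM r ⟨hs.1.trans hrs.1.le, hrs.2⟩
      have h6 : ‖v r‖ ≤ ‖f (z r)‖ + ‖v r - f (z r)‖ := by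
        simpa using norm_add_le (f (z r)) (v r - f (z r))
      have h7 : η * (‖z r‖ + m) ≤ 1 * (‖z r‖ + m) := by gcongr
      have h8 : ‖ys r - ly (z r)‖ + ‖us r - lu (z r)‖ + ω ≤ 2 * (‖z r‖ + m) + m := by linarith
      calc ‖v r‖ ≤ κ * ‖z r‖ + κ * (2 * (‖z r‖ + m) + m) :=
            h6.trans (add_le_add (hf _) (h2.trans (by gcongr)))
        _ = 3 * κ * (‖z r‖ + m) := by ring
        _ ≤ 3 * κ * M := by gcongr
    rw [abs_of_nonneg (by linarith [hs.2])] at h1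
    linarith
  have hcont : ContinuousWithinAt z (Ici t) t := (hzc t ht0).mono (Ici_subset_Ici.2 ht0)
  have key : ∀ {n : ℕ} {T : TriggerParams} {l : Z →L[ℝ] Vec n} {ξs : ℝ → Vec n} {tk : ℕ → EReal},
      T.IsFine (3 * κ) ℓ η m → (∀ z, ‖l z‖ ≤ ℓ * ‖z‖) →
      IsTriggerSequence T (fun t => l (z t)) tk → IsSampled tk (fun t => l (z t)) ξs →
      ∀ᶠ s in 𝓝[≥] t, ‖ξs s - l (z s)‖ ≤ η * (‖z s‖ + m) := by
    intro n T l ξs tk hT hl htk hs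
    have h1 := sampling_error_le hT (by positivity) hℓ hzc hl hm.le htk hs ht0 hinc
    -- The gain from `η` to `η / 2` is strict because `m > 0`, so the bound persists to the right of
    -- `t`, contradicting the choice of `t` as infimum of the bad times.
    have h2 : ‖ξs t - l (z t)‖ < η * (‖z t‖ + m) := by
      have : 0 < η * (‖z t‖ + m) := by positivity
      linarith
    have h3 : ∀ᶠ s in 𝓝[≥] t, ‖ξs t - l (z s)‖ < η * (‖z s‖ + m) :=
      Tendsto.eventually_lt
        (continuousWithinAt_const.sub (l.continuous.continuousAt.comp_continuousWithinAt hcont)).norm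
        (continuousWithinAt_const.mul (hcont.norm.add continuousWithinAt_const)) h2
    filter_upwards [h3, hs.eventually_eq hT.τ_pos htk ht0] with s h4 h5
    rw [h5]
    exact h4.le
  obtain ⟨u, hu, hsub⟩ := mem_nhdsGE_iff_exists_Ico_subset.1
    ((key hTy hly hty hys).and (key hTu hlu htu hus))
  have : u ≤ t := le_csInf hBne fun s hs => by
    by_contra h
    exact hs.2 (hsub ⟨csInf_le hBb hs, not_le.1 h⟩)
  exact absurd hu (not_lt.2 this)

end SamplingError

/-! ### Lyapunov estimate for perturbed Carathéodory solutions -/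

section Lyapunov

variable {Z : Type*} [NormedAddCommGroup Z] [NormedSpace ℝ Z]

theorem mul_le_sq_add_sq_div {x y k : ℝ} (hk : 0 < k) : x * y ≤ k / 4 * x ^ 2 + y ^ 2 / k := by
  have : k / 4 * x ^ 2 + y ^ 2 / k - x * y = (k * x - 2 * y) ^ 2 / (4 * k) := by
    field_simp; ring
  have h2 : 0 ≤ (k * x - 2 * y) ^ 2 / (4 * k) := by positivity
  linarith

/-- The upper right Dini derivative of a quadratic function along a perturbed solution. -/
theorem eventually_slope_lt [CompleteSpace Z] {z v : ℝ → Z}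
    (hz : ∀ t, 0 ≤ t → IntervalIntegrable v volume 0 t ∧ z t = z 0 + ∫ s in (0 : ℝ)..t, v s)
    {f : Z → Z} (hf : Continuous f) {V : Z → ℝ} {DV : Z → Z →L[ℝ] ℝ} {a : ℝ} (ha : 0 ≤ a)
    (hexp : ∀ z h, V (z + h) ≤ V z + DV z h + a * ‖h‖ ^ 2) (hDV : ∀ z, ‖DV z‖ ≤ 2 * a * ‖z‖)
    {p q : ℝ} (hv : ∀ᵐ t : ℝ, 0 ≤ t → ‖v t - f (z t)‖ ≤ p * ‖z t‖ + q) {s r : ℝ} (hs : 0 ≤ s)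
    (hr : DV (z s) (f (z s)) + 2 * a * ‖z s‖ * (p * ‖z s‖ + q) < r) :
    ∀ᶠ t in 𝓝[>] s, (t - s)⁻¹ * (V (z t) - V (z s)) < r := by
  have hzc : Continuous fun t => z (max t 0) :=
    (continuousOn_of_eq_integral hz).comp_continuous (by fun_prop) fun t => le_max_right t 0
  have hze : ∀ t, 0 ≤ t → z (max t 0) = z t := fun t ht => by rw [max_eq_left ht]
  -- For almost every time after `s`, `g` dominates `‖v - f (z s)‖`. Unlike `v` it is continuous, so
  -- its primitive is differentiable at `s`.
  set g : ℝ → ℝ := fun t => p * ‖z (max t 0)‖ + q + ‖f (z (max t 0)) - f (z s)‖ with hg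
  have hgc : Continuous g := ((continuous_const.mul hzc.norm).add continuous_const).add
    ((hf.comp hzc).sub continuous_const).norm
  have hgs : g s = p * ‖z s‖ + q := by simp [hg, hze s hs]
  set I : ℝ → ℝ := fun t => ∫ r in s..t, g r with hI
  have hI' : HasDerivAt I (g s) s :=
    intervalIntegral.integral_hasDerivAt_right (hgc.intervalIntegrable _ _)
      (hgc.stronglyMeasurableAtFilter _ _) hgc.continuousAt
  have hIs : I s = 0 := by simp [hI]
  have hR : ∀ t, s ≤ t → ‖z t - z s - (t - s) • f (z s)‖ ≤ I t := by
    intro t hst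
    obtain ⟨h1, h2⟩ := sub_eq_integral hz hs (hs.trans hst)
    have h3 : (t - s) • f (z s) = ∫ _ in s..t, f (z s) := by simp
    rw [h2, h3, ← intervalIntegral.integral_sub h1 intervalIntegrable_const]
    refine intervalIntegral.norm_integral_le_of_norm_le hst ?_ (hgc.intervalIntegrable _ _)
    filter_upwards [hv] with r hr hrs
    have hr0 : 0 ≤ r := hs.trans hrs.1.le
    have h4 := norm_add_le (v r - f (z r)) (f (z r) - f (z s))
    rw [sub_add_sub_cancel] at h4
    simp only [hg, hze r hr0]
    linarith [hr hr0]
  -- A differentiable majorant of `V (z t) - V (z s)` that vanishes at `s`; its quadratic term does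
  -- not contribute to the derivative there.
  set H : ℝ → ℝ := fun t => (t - s) * DV (z s) (f (z s)) + 2 * a * ‖z s‖ * I t
    + a * ((t - s) * ‖f (z s)‖ + I t) ^ 2 with hH
  have hHs : H s = 0 := by simp [hH, hIs]
  have hHd : HasDerivAt H (DV (z s) (f (z s)) + 2 * a * ‖z s‖ * (p * ‖z s‖ + q)) s := by
    have hid : HasDerivAt (fun t : ℝ => t - s) 1 s := (hasDerivAt_id s).sub_const s
    have := ((hid.mul_const (DV (z s) (f (z s)))).add (hI'.const_mul (2 * a * ‖z s‖))).add
      ((((hid.mul_const ‖f (z s)‖).add hI').pow 2).const_mul a)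
    convert! this using 1
    simp [hIs, hgs]
  have hle : ∀ t, s ≤ t → V (z t) - V (z s) ≤ H t := by
    intro t hst
    have h1 := hexp (z s) (z t - z s)
    rw [add_sub_cancel] at h1
    have h2 := hR t hst
    have h3 : DV (z s) (z t - z s) ≤ (t - s) * DV (z s) (f (z s)) + 2 * a * ‖z s‖ * I t := by
      have h4 : DV (z s) (z t - z s) = (t - s) * DV (z s) (f (z s))
          + DV (z s) (z t - z s - (t - s) • f (z s)) := by
        rw [map_sub (DV (z s)) (z t - z s), map_smul, smul_eq_mul]; ring
      have h5 : DV (z s) (z t - z s - (t - s) • f (z s)) ≤ 2 * a * ‖z s‖ * I t :=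
        (le_abs_self _).trans (((DV (z s)).le_opNorm _).trans
          (mul_le_mul (hDV _) h2 (norm_nonneg _) (by positivity)))
      linarith
    have h6 : ‖z t - z s‖ ≤ (t - s) * ‖f (z s)‖ + I t := by
      have h7 := norm_add_le ((t - s) • f (z s)) (z t - z s - (t - s) • f (z s))
      rw [add_sub_cancel, norm_smul, Real.norm_of_nonneg (sub_nonneg.2 hst)] at h7
      linarith
    have h8 : a * ‖z t - z s‖ ^ 2 ≤ a * ((t - s) * ‖f (z s)‖ + I t) ^ 2 := by gcongr
    simp only [hH]
    linarith
  have hslope := (hasDerivWithinAt_iff_tendsto_slope' (lt_irrefl s : s ∉ Ioi s)).1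
    (hHd.hasDerivWithinAt (s := Ioi s))
  filter_upwards [hslope.eventually (gt_mem_nhds hr), self_mem_nhdsWithin] with t ht hst
  have hst' : s < t := hst
  rw [slope_def_field, hHs, sub_zero, div_eq_inv_mul] at ht
  refine lt_of_le_of_lt ?_ ht
  have : 0 < t - s := sub_pos.2 hst'
  gcongr
  exact hle t hst'.le

/-- A perturbed solution of a system with a quadratic Lyapunov function decays exponentially up to
a multiple of the size of the perturbation. -/
theorem norm_le_of_lyapunov [CompleteSpace Z] {z v : ℝ → Z}
    (hz : ∀ t, 0 ≤ t → IntervalIntegrable v volume 0 t ∧ z t = z 0 + ∫ s in (0 : ℝ)..t, v s)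
    {f : Z → Z} (hf : Continuous f) {V : Z → ℝ} (hVc : Continuous V) {DV : Z → Z →L[ℝ] ℝ}
    {a₁ a₂ α : ℝ} (ha₁ : 0 < a₁) (ha₂ : 0 < a₂) (hα : 0 < α)
    (hexp : ∀ z h, V (z + h) ≤ V z + DV z h + a₂ * ‖h‖ ^ 2) (hDV : ∀ z, ‖DV z‖ ≤ 2 * a₂ * ‖z‖)
    (hlow : ∀ z, a₁ * ‖z‖ ^ 2 ≤ V z) (hup : ∀ z, V z ≤ a₂ * ‖z‖ ^ 2)
    (hdec : ∀ z, DV z (f z) ≤ -α * V z) {p q : ℝ} (hq : 0 ≤ q) (hp : 2 * a₂ * p ≤ α * a₁ / 4)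
    (hv : ∀ᵐ t : ℝ, 0 ≤ t → ‖v t - f (z t)‖ ≤ p * ‖z t‖ + q) {t : ℝ} (ht : 0 ≤ t) :
    ‖z t‖ ≤ √(a₂ / a₁) * Real.exp (-(α / 4) * t) * ‖z 0‖ + 3 * a₂ / (α * a₁) * q := by
  have hzc := continuousOn_of_eq_integral hz
  -- Young's inequality with weight `α a₁` leaves `C` and `α a₁ / 4 * ‖z‖ ^ 2`. With the equal share
  -- from `p`, this uses up half the decay, leaving the rate `α / 2` for `V`.
  set C : ℝ := (2 * a₂ * q) ^ 2 / (α * a₁) with hC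
  have hbound : V (z t) ≤ gronwallBound (V (z 0)) (-(α / 2)) C (t - 0) := by
    refine le_gronwallBound_of_liminf_deriv_right_le (f := fun t => V (z t)) (a := 0) (b := t)
      (f' := fun s => DV (z s) (f (z s)) + 2 * a₂ * ‖z s‖ * (p * ‖z s‖ + q))
      (hVc.comp_continuousOn (hzc.mono fun s hs => hs.1))
      (fun s hs r hr => (eventually_slope_lt hz hf ha₂.le hexp hDV hv hs.1 hr).frequently)
      le_rfl (fun s _ => ?_) t ⟨ht, le_rfl⟩
    have h1 := hdec (z s)
    have h2 := mul_le_mul_of_nonneg_right hp (sq_nonneg ‖z s‖)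
    have h3 := mul_le_sq_add_sq_div (x := ‖z s‖) (y := 2 * a₂ * q) (mul_pos hα ha₁)
    have h4 := mul_le_mul_of_nonneg_left (hlow (z s)) hα.le
    simp only [hC]
    nlinarith
  rw [gronwallBound_of_K_ne_0 (by linarith), sub_zero] at hbound
  have hC0 : 0 ≤ C := by positivity
  have h1 : C / -(α / 2) * (Real.exp (-(α / 2) * t) - 1) ≤ C * 2 / α := by
    have : C / -(α / 2) * (Real.exp (-(α / 2) * t) - 1)
        = C * 2 / α * (1 - Real.exp (-(α / 2) * t)) := by
      field_simp; ring
    rw [this]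
    have h2 := Real.exp_pos (-(α / 2) * t)
    exact mul_le_of_le_one_right (by positivity) (by linarith)
  have h2 : V (z 0) * Real.exp (-(α / 2) * t) ≤ a₂ * ‖z 0‖ ^ 2 * Real.exp (-(α / 2) * t) :=
    mul_le_mul_of_nonneg_right (hup _) (Real.exp_pos _).le
  have h3 := hlow (z t)
  set A := √(a₂ / a₁) * Real.exp (-(α / 4) * t) * ‖z 0‖ with hA
  -- The exact factor would be `√8`; it is rounded up to `3`.
  set B := 3 * a₂ / (α * a₁) * q with hB
  have hA0 : 0 ≤ A := by positivity
  have hB0 : 0 ≤ B := by positivity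
  have hA2 : a₁ * A ^ 2 = a₂ * ‖z 0‖ ^ 2 * Real.exp (-(α / 2) * t) := by
    have he : Real.exp (-(α / 4) * t) ^ 2 = Real.exp (-(α / 2) * t) := by
      rw [← Real.exp_nat_mul]; congr 1; push_cast; ring
    rw [hA, mul_pow, mul_pow, he, Real.sq_sqrt (by positivity)]
    field_simp
  have hB2 : C * 2 / α ≤ a₁ * B ^ 2 := by
    have h4 : C * 2 / α = 8 * (a₂ ^ 2 * q ^ 2 / (α ^ 2 * a₁)) := by
      rw [hC]; field_simp; ring
    have h5 : a₁ * B ^ 2 = 9 * (a₂ ^ 2 * q ^ 2 / (α ^ 2 * a₁)) := by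
      rw [hB]; field_simp; ring
    have h6 : 0 ≤ a₂ ^ 2 * q ^ 2 / (α ^ 2 * a₁) := by positivity
    rw [h4, h5]; linarith
  have h4 : a₁ * ‖z t‖ ^ 2 ≤ a₁ * (A + B) ^ 2 := by
    have : 0 ≤ a₁ * (2 * (A * B)) := by positivity
    nlinarith
  exact le_of_sq_le_sq (le_of_mul_le_mul_left h4 ha₁) (by positivity)

end Lyapunov

/-! ### Quadratic forms -/

section QuadForm

variable {n : ℕ} (P : Matrix (Fin n ⊕ Fin n) (Fin n ⊕ Fin n) ℝ)

/-- The expansion is exact with remainder `V h`. The upper bounds come from the operator norm of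
`P`, the lower one from the minimum of `V` on the compact unit sphere and homogeneity. -/
theorem exists_quadForm_bounds (hP : P.PosDef) : ∃ a₁ a₂ : ℝ, 0 < a₁ ∧ 0 < a₂ ∧
    Continuous (quadForm P) ∧
    (∀ z h, quadForm P (z + h)
      ≤ quadForm P z + fderiv ℝ (quadForm P) z h + a₂ * ‖h‖ ^ 2) ∧
    (∀ z, ‖fderiv ℝ (quadForm P) z‖ ≤ 2 * a₂ * ‖z‖) ∧
    (∀ z, a₁ * ‖z‖ ^ 2 ≤ quadForm P z) ∧ (∀ z, quadForm P z ≤ a₂ * ‖z‖ ^ 2) := by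
  set L : State n →L[ℝ] State n := LinearMap.toContinuousLinearMap (Matrix.toEuclideanLin P)
    with hL
  have hq : quadForm P = fun z => inner ℝ (L z) z := by
    funext z
    simp [quadForm, hL, EuclideanSpace.inner_eq_star_dotProduct, Matrix.toEuclideanLin,
      Matrix.toLpLin_apply]
  have hd : ∀ z, HasFDerivAt (quadForm P)
      ((fderivInnerCLM ℝ (L z, z)).comp (L.prod (ContinuousLinearMap.id ℝ _))) z := by
    intro z
    rw [hq]
    exact L.hasFDerivAt.inner ℝ (hasFDerivAt_id z)
  have hd' : ∀ z h, fderiv ℝ (quadForm P) z h = inner ℝ (L z) h + inner ℝ (L h) z := by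
    intro z h
    rw [(hd z).fderiv]
    simp
  have hin : ∀ z h : State n, inner ℝ (L z) h ≤ ‖L‖ * ‖z‖ * ‖h‖ := fun z h =>
    (real_inner_le_norm _ _).trans (mul_le_mul_of_nonneg_right (L.le_opNorm z) (norm_nonneg _))
  have hin' : ∀ z h : State n, |inner ℝ (L z) h| ≤ ‖L‖ * ‖z‖ * ‖h‖ := fun z h =>
    (abs_real_inner_le_norm _ _).trans
      (mul_le_mul_of_nonneg_right (L.le_opNorm z) (norm_nonneg _))
  have hc : Continuous (quadForm P) := by
    rw [hq]; fun_prop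
  have hpos : ∀ z : State n, z ≠ 0 → 0 < quadForm P z := by
    intro z hz
    have := hP.dotProduct_mulVec_pos (x := z.ofLp) (by simpa using hz)
    simpa [quadForm] using this
  have hup : ∀ z, quadForm P z ≤ (‖L‖ + 1) * ‖z‖ ^ 2 := by
    intro z
    have h1 : quadForm P z ≤ ‖L‖ * ‖z‖ * ‖z‖ := by rw [hq]; exact hin z z
    nlinarith [sq_nonneg ‖z‖]
  obtain ⟨a₁, ha₁, hlow⟩ : ∃ a₁ : ℝ, 0 < a₁ ∧ ∀ z, a₁ * ‖z‖ ^ 2 ≤ quadForm P z := by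
    obtain ⟨a₁, ha₁, hs⟩ : ∃ a₁ : ℝ, 0 < a₁ ∧
        ∀ z ∈ Metric.sphere (0 : State n) 1, a₁ ≤ quadForm P z := by
      -- The sphere is empty in dimension zero.
      rcases (Metric.sphere (0 : State n) 1).eq_empty_or_nonempty with h | h
      · exact ⟨1, one_pos, by simp [h]⟩
      · obtain ⟨z₀, hz₀, hmin⟩ := (isCompact_sphere (0 : State n) 1).exists_isMinOn h
          hc.continuousOn
        refine ⟨quadForm P z₀, hpos z₀ ?_, fun z hz => hmin hz⟩
        rintro rfl
        simp at hz₀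
    refine ⟨a₁, ha₁, fun z => ?_⟩
    rcases eq_or_ne z 0 with rfl | hz
    · simp [hq]
    · have hz' : ‖z‖ ≠ 0 := norm_ne_zero_iff.2 hz
      have h1 := hs (‖z‖⁻¹ • z) (by simp [norm_smul, hz'])
      have h2 : quadForm P (‖z‖⁻¹ • z) = (‖z‖ ^ 2)⁻¹ * quadForm P z := by
        rw [hq]
        simp only [map_smul, real_inner_smul_left, real_inner_smul_right]
        field_simp
      rw [h2] at h1
      have h3 : 0 < ‖z‖ ^ 2 := by positivity
      rwa [← div_eq_inv_mul, le_div_iff₀ h3] at h1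
  refine ⟨a₁, ‖L‖ + 1, ha₁, by positivity, hc, fun z h => ?_, fun z => ?_, hlow, hup⟩
  · have h1 : quadForm P (z + h)
        = quadForm P z + fderiv ℝ (quadForm P) z h + quadForm P h := by
      rw [hd', hq]
      simp only [map_add, inner_add_left, inner_add_right]
      ring
    linarith [hup h]
  · refine ContinuousLinearMap.opNorm_le_bound _ (by positivity) fun h => ?_
    rw [hd', Real.norm_eq_abs]
    have h1 := hin' z h
    have h2 := hin' h z
    have h3 : 0 ≤ ‖z‖ * ‖h‖ := by positivity
    refine (abs_add_le _ _).trans ?_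
    nlinarith

end QuadForm

/-! ### The event-triggered closed loop -/

section ClosedLoop

variable {nx nu ny nq np nw : ℕ} {S : Plant nx nu ny nq np nw} {G : Gains nx nu ny nq np}

theorem ae_norm_le_of_mem_disturbances {m : ℕ} {ω₀ : ℝ} {w : ℝ → Vec m}
    (hw : w ∈ Disturbances m ω₀) : ∀ᵐ t : ℝ, 0 ≤ t → ‖w t‖ ≤ (inputNorm w).toReal := by
  have htop : inputNorm w ≠ ⊤ := ne_top_of_le_ne_top ENNReal.ofReal_ne_top hw.2
  have h1 : ∀ᵐ t ∂(volume.restrict (Ici (0 : ℝ))), ‖w t‖ₑ ≤ inputNorm w := by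
    rw [inputNorm, eLpNorm_exponent_top]
    exact ae_le_eLpNormEssSup
  filter_upwards [(ae_restrict_iff' measurableSet_Ici).1 h1] with t ht h0
  rw [← toReal_enorm]
  exact ENNReal.toReal_mono htop (ht h0)

theorem intervalIntegrable_of_mem_disturbances {m : ℕ} {ω₀ : ℝ} {w : ℝ → Vec m}
    (hw : w ∈ Disturbances m ω₀) {s t : ℝ} (hs : 0 ≤ s) (hst : s ≤ t) :
    IntervalIntegrable w volume s t := by
  rw [intervalIntegrable_iff_integrableOn_Ioc_of_le hst]
  have hsub : Ioc s t ⊆ Ici 0 := fun r hr => hs.trans hr.1.le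
  refine Integrable.of_bound (hw.1.mono_measure (Measure.restrict_mono hsub le_rfl))
    (inputNorm w).toReal ?_
  refine (ae_restrict_iff' measurableSet_Ioc).2 ?_
  filter_upwards [ae_norm_le_of_mem_disturbances hw] with r hr hrs
  exact hr (hsub hrs)

/-- From every initial state and for every disturbance there is a trajectory on `[0, ∞)`. -/
theorem exists_triggeredSolution (hD : S.D = 0) (hFw : S.Fw = 0)
    (hp : ∃ ℓ : NNReal, LipschitzWith ℓ S.p) {Ty Tu : TriggerParams} (hTy : 0 < Ty.τ)
    (hTu : 0 < Tu.τ) {ω₀ : ℝ} {w : ℝ → Vec nw} (hw : w ∈ Disturbances nw ω₀) (z₀ : State nx) :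
    ∃ z, IsTriggeredSolution S G Ty Tu w z ∧ z 0 = z₀ := by
  obtain ⟨K, hK⟩ := exists_lipschitz_jointField (S := S) G hp
  have hact : Continuous fun v : Vec nx => act S.C v :=
    (LinearMap.toContinuousLinearMap (Matrix.toEuclideanLin S.C)).continuous
  have hf : ∀ (y : Vec ny) (u : Vec nx),
      LipschitzWith K fun ξ : Vec nx × Vec nx => jointField S G (ξ, (y, u), 0) := fun y u => by
    have := hK.comp (LipschitzWith.prodMk_right (α := Vec nx × Vec nx)
      (((y, u), 0) : (Vec ny × Vec nx) × Vec nw))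
    simpa [Function.comp_def] using this
  have hg : ∀ s t, 0 ≤ s → s ≤ t →
      IntervalIntegrable (fun r => ((act S.Ew (w r), 0) : Vec nx × Vec nx)) volume s t := by
    intro s t hs hst
    have h1 := intervalIntegrable_of_mem_disturbances hw hs hst
    let M : Vec nw →L[ℝ] Vec nx × Vec nx := (ContinuousLinearMap.inl ℝ (Vec nx) (Vec nx)).comp
      (LinearMap.toContinuousLinearMap (Matrix.toEuclideanLin S.Ew))
    exact ⟨M.integrable_comp h1.1, M.integrable_comp h1.2⟩
  obtain ⟨ξ, hξ0, hξ⟩ := exists_global_solution (Ty := Ty) (Tu := Tu)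
    (ly := fun ξ : Vec nx × Vec nx => act S.C ξ.1) (lu := fun ξ => ξ.2) hTy hTu
    (hact.comp continuous_fst) continuous_snd hf hg (ofState nx z₀)
  have hξc : Continuous ξ := (hξ 0).1
  set ys := held Ty fun t => act S.C (ξ t).1 with hys
  set xs := held Tu fun t => (ξ t).2 with hxs
  have hfield : sampledField Ty Tu (fun ξ : Vec nx × Vec nx => act S.C ξ.1) (fun ξ => ξ.2)
      (fun y u ξ => jointField S G (ξ, (y, u), 0)) (fun r => (act S.Ew (w r), 0)) ξ
      = fun t => jointField S G (ξ t, (ys t, xs t), w t) := by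
    funext t
    rw [sampledField, ← jointField_eq_add]
  have hsol : ∀ t, 0 ≤ t →
      IntervalIntegrable (fun t => jointField S G (ξ t, (ys t, xs t), w t)) volume 0 t ∧
      ξ t = ξ 0 + ∫ s in (0 : ℝ)..t, jointField S G (ξ s, (ys s, xs s), w s) := by
    intro t ht
    have := (hξ t).2 t ht le_rfl
    rwa [hfield] at this
  refine ⟨fun t => stack (ξ t).1 ((ξ t).1 - (ξ t).2), ⟨fun t => (ξ t).1, fun t => (ξ t).2, xs, ys,
    eventTime Ty fun t => act S.C (ξ t).1, eventTime Tu fun t => (ξ t).2, ?_, rfl⟩, ?_⟩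
  · refine ⟨?_, ?_, ?_, ?_, fun t ht => ?_, fun t ht => ?_⟩
    · simp only [output_eq hD hFw]
      exact isTriggerSequence_eventTime (hact.comp (continuous_fst.comp hξc))
    · simp only [output_eq hD hFw]
      exact isSampled_held hTy
    · exact isTriggerSequence_eventTime (continuous_snd.comp hξc)
    · exact isSampled_held hTu
    · obtain ⟨h1, h2⟩ := hsol t ht
      refine ⟨⟨h1.1.fst, h1.2.fst⟩, ?_⟩
      have h3 := (ContinuousLinearMap.fst ℝ (Vec nx) (Vec nx)).intervalIntegral_comp_comm h1
      have h4 := congrArg Prod.fst h2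
      rw [Prod.fst_add] at h4
      exact h4.trans (congrArg _ h3.symm)
    · obtain ⟨h1, h2⟩ := hsol t ht
      refine ⟨⟨h1.1.snd, h1.2.snd⟩, ?_⟩
      have h3 := (ContinuousLinearMap.snd ℝ (Vec nx) (Vec nx)).intervalIntegral_comp_comm h1
      have h4 := congrArg Prod.snd h2
      rw [Prod.snd_add] at h4
      exact h4.trans (congrArg _ h3.symm)
  · change toState nx (ξ 0) = z₀
    rw [hξ0, toState_ofState]

/-- The state `z` along a trajectory as a Carathéodory solution. -/
theorem IsTriggeredTrajectory.toState_eq_integral {Ty Tu : TriggerParams} {w : ℝ → Vec nw}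
    {x xh xs : ℝ → Vec nx} {ys : ℝ → Vec ny} {ty tu : ℕ → EReal}
    (h : IsTriggeredTrajectory S G Ty Tu w x xh xs ys ty tu) (t : ℝ) (ht : 0 ≤ t) :
    IntervalIntegrable (fun s => toState nx (jointField S G ((x s, xh s), (ys s, xs s), w s)))
        volume 0 t ∧
      toState nx (x t, xh t) = toState nx (x 0, xh 0)
        + ∫ s in (0 : ℝ)..t, toState nx (jointField S G ((x s, xh s), (ys s, xs s), w s)) := by
  obtain ⟨h1, h2⟩ := h.plant t ht
  obtain ⟨h3, h4⟩ := h.observer t ht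
  let T₁ := (toState nx).comp (ContinuousLinearMap.inl ℝ (Vec nx) (Vec nx))
  let T₂ := (toState nx).comp (ContinuousLinearMap.inr ℝ (Vec nx) (Vec nx))
  have hT : ∀ u v, toState nx (u, v) = T₁ u + T₂ v := fun u v => by
    simp [T₁, T₂, ← map_add]
  have h5 : IntervalIntegrable
      (fun s => T₁ (plantField S (x s) (feedback S G (xs s)) (w s))) volume 0 t :=
    ⟨T₁.integrable_comp h1.1, T₁.integrable_comp h1.2⟩
  have h6 : IntervalIntegrable
      (fun s => T₂ (observerField S G (xh s) (feedback S G (xs s)) (ys s))) volume 0 t :=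
    ⟨T₂.integrable_comp h3.1, T₂.integrable_comp h3.2⟩
  simp only [jointField, hT]
  refine ⟨h5.add h6, ?_⟩
  rw [intervalIntegral.integral_add h5 h6, T₁.intervalIntegral_comp_comm h1,
    T₂.intervalIntegral_comp_comm h3, h2, h4, map_add, map_add]
  abel

end ClosedLoop

/-! ### Comparison functions and the choice of the trigger parameters -/

theorem classK_mul {c : ℝ} (hc : 0 < c) : ClassK fun r => c * r where
  continuousOn := by fun_prop
  strictMonoOn := fun _ _ _ _ h => mul_lt_mul_of_pos_left h hc
  map_zero := mul_zero c

theorem classKL_exp {k r : ℝ} (hk : 0 < k) (hr : 0 < r) :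
    ClassKL fun s t => k * Real.exp (-r * t) * s where
  continuousOn := by fun_prop
  classK t _ := classK_mul (by positivity)
  antitoneOn s hs t _ t' _ h := by
    have h1 : -r * t' ≤ -r * t := by nlinarith
    exact mul_le_mul_of_nonneg_right
      (mul_le_mul_of_nonneg_left (Real.exp_le_exp.2 h1) hk.le) hs
  tendsto_zero s _ := by
    have h1 : Tendsto (fun t : ℝ => -r * t) atTop atBot :=
      tendsto_id.const_mul_atTop_of_neg (by linarith)
    have h2 := ((Real.tendsto_exp_atBot.comp h1).const_mul k).mul_const s
    simpa using! h2

/-- The exponential estimate for the event-triggered closed loop, uniform in the disturbance. -/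
theorem exists_trigger_estimate {nx nu ny nq np nw : ℕ} {S : Plant nx nu ny nq np nw}
    (hD : S.D = 0) (hFw : S.Fw = 0) (hp0 : S.p 0 = 0) (hp : ∃ ℓ : NNReal, LipschitzWith ℓ S.p)
    (G : Gains nx nu ny nq np)
    {P : Matrix (Fin nx ⊕ Fin nx) (Fin nx ⊕ Fin nx) ℝ} (hP : P.PosDef) {α : ℝ} (hα : 0 < α)
    (hV : ∀ z : State nx,
      fderiv ℝ (quadForm P) z (closedLoopField S G z 0) ≤ -α * quadForm P z) :
    ∃ (T : TriggerParams) (k r c : ℝ), T.Pos ∧ 0 < k ∧ 0 < r ∧ 0 < c ∧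
      ∀ ω₀, ∀ w ∈ Disturbances nw ω₀, ∀ z, IsTriggeredSolution S G T T w z → ∀ t, 0 ≤ t →
        ‖z t‖ ≤ k * Real.exp (-r * t) * ‖z 0‖ + c * (inputNorm w).toReal + c := by
  obtain ⟨κ, hκ, hfc, hfκ, hpert⟩ := exists_closedLoop_bounds G hD hFw hp0 hp
  obtain ⟨a₁, a₂, ha₁, ha₂, hVc, hexp, hDV, hlow, hup⟩ := exists_quadForm_bounds P hP
  let ly : State nx →L[ℝ] Vec ny :=
    (LinearMap.toContinuousLinearMap (Matrix.toEuclideanLin S.C)).comp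
      ((ContinuousLinearMap.fst ℝ (Vec nx) (Vec nx)).comp (ofState nx))
  let lu : State nx →L[ℝ] Vec nx :=
    (ContinuousLinearMap.snd ℝ (Vec nx) (Vec nx)).comp (ofState nx)
  set ℓ : ℝ := 1 + ‖ly‖ + ‖lu‖ with hℓ
  have hℓ1 : 1 ≤ ℓ := by linarith [norm_nonneg ly, norm_nonneg lu]
  have hly : ∀ z, ‖ly z‖ ≤ ℓ * ‖z‖ := fun z => (ly.le_opNorm z).trans
    (mul_le_mul_of_nonneg_right (by linarith [norm_nonneg lu]) (norm_nonneg z))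
  have hlu : ∀ z, ‖lu z‖ ≤ ℓ * ‖z‖ := fun z => (lu.le_opNorm z).trans
    (mul_le_mul_of_nonneg_right (by linarith [norm_nonneg ly]) (norm_nonneg z))
  -- The second entry makes the relative perturbation `p = 2 κ η` satisfy the smallness condition of
  -- `norm_le_of_lyapunov`.
  set η : ℝ := min 1 (α * a₁ / (16 * a₂ * κ)) with hη
  have hη0 : 0 < η := lt_min one_pos (by positivity)
  have hη1 : η ≤ 1 := min_le_left _ _
  have hη2 : 2 * a₂ * (2 * κ * η) ≤ α * a₁ / 4 := by
    have h1 : η ≤ α * a₁ / (16 * a₂ * κ) := min_le_right _ _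
    rw [le_div_iff₀ (by positivity)] at h1
    linarith
  have hℓ0 : 0 < ℓ := by linarith
  -- The values of `τ` and `σ` give equality in `gain` and `σ_le` for the growth constant `3 κ`; `ε
  -- = η / 2` suffices because `m ≥ 1`.
  refine ⟨⟨η / (12 * ℓ * κ), η / (2 * ℓ), η / 2⟩, √(a₂ / a₁), α / 4,
    3 * a₂ / (α * a₁) * (3 * κ), ⟨?_, ?_, ?_⟩, ?_, ?_, ?_, ?_⟩
  iterate 6 (show (0 : ℝ) < _; positivity)
  rintro ω₀ w hw z ⟨x, xh, xs, ys, ty, tu, htraj, rfl⟩ t ht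
  set ω := (inputNorm w).toReal with hω
  have hω0 : 0 ≤ ω := ENNReal.toReal_nonneg
  -- The offset `m = ω + 1` dominates `ω` and stays positive when `w = 0`; the `1` becomes the
  -- practical constant `d`.
  have hfine : (⟨η / (12 * ℓ * κ), η / (2 * ℓ), η / 2⟩ : TriggerParams).IsFine (3 * κ) ℓ η
      (ω + 1) := by
    refine ⟨by positivity, by positivity, ?_, ?_, ?_, ?_⟩ <;> dsimp only
    · have h1 : 3 * κ * (η / (12 * ℓ * κ)) = η / (4 * ℓ) := by field_simp; norm_num
      rw [h1, div_le_iff₀ (by positivity)]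
      linarith
    · apply le_of_eq; field_simp; norm_num
    · apply le_of_eq; field_simp
    · nlinarith
  have hz := htraj.toState_eq_integral
  have hly' : ∀ t, ly (toState nx (x t, xh t)) = act S.C (x t) := fun t => by
    simp [ly, ofState_toState]
  have hlu' : ∀ t, lu (toState nx (x t, xh t)) = xh t := fun t => by
    simp [lu, ofState_toState]
  have hty := htraj.output_trigger
  have hys := htraj.output_sampled
  have htu := htraj.control_trigger
  have hxs := htraj.control_sampled
  simp only [output_eq hD hFw] at hty hys
  have hv : ∀ᵐ t : ℝ, 0 ≤ t →
      ‖toState nx (jointField S G ((x t, xh t), (ys t, xs t), w t))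
        - closedLoopField S G (toState nx (x t, xh t)) 0‖
      ≤ κ * (‖ys t - ly (toState nx (x t, xh t))‖ + ‖xs t - lu (toState nx (x t, xh t))‖ + ω) := by
    filter_upwards [ae_norm_le_of_mem_disturbances hw] with s hs h0
    rw [hly', hlu']
    refine (hpert (x s, xh s) (ys s) (xs s) (w s)).trans ?_
    have := hs h0
    gcongr
  have herr := sampling_errors_le (z := fun t => toState nx (x t, xh t)) hz hκ hfκ hℓ0.le hly hlu
    (by positivity : 0 < ω + 1) (by linarith) hη0 hη1 hfine hfine (ys := ys) (us := xs)
    (by simpa only [hly'] using hty) (by simpa only [hly'] using hys)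
    (by simpa only [hlu'] using htu) (by simpa only [hlu'] using hxs) hv
  have hv' : ∀ᵐ t : ℝ, 0 ≤ t →
      ‖toState nx (jointField S G ((x t, xh t), (ys t, xs t), w t))
        - closedLoopField S G (toState nx (x t, xh t)) 0‖
      ≤ 2 * κ * η * ‖toState nx (x t, xh t)‖ + 3 * κ * (ω + 1) := by
    filter_upwards [hv] with s hs h0
    obtain ⟨h1, h2⟩ := herr s h0
    have h3 : η * (ω + 1) ≤ 1 * (ω + 1) := by gcongr
    calc _ ≤ _ := hs h0
      _ ≤ κ * (2 * (η * ‖toState nx (x s, xh s)‖) + 3 * (ω + 1)) := by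
          refine mul_le_mul_of_nonneg_left ?_ hκ.le
          linarith
      _ = _ := by ring
  have := norm_le_of_lyapunov (z := fun t => toState nx (x t, xh t)) hz hfc hVc ha₁ ha₂ hα hexp
    hDV hlow hup hV (by positivity) hη2 hv' ht
  simp only [toState_apply] at this
  linarith

end EventTriggered

theorem mainTheorem6 {nx nu ny nq np nw : ℕ}
    (S : EventTriggered.Plant nx nu ny nq np nw)
    (hD : S.D = 0) (hFw : S.Fw = 0)
    (hp0 : S.p 0 = 0) (hp : ∃ ℓ : NNReal, LipschitzWith ℓ S.p)
    (ω₀ : ℝ) (hω₀ : 0 < ω₀)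
    (G : EventTriggered.Gains nx nu ny nq np)
    (P : Matrix (Fin nx ⊕ Fin nx) (Fin nx ⊕ Fin nx) ℝ) (hP : P.PosDef)
    (α₀ : ℝ) (hα₀ : 0 < α₀)
    (hV : ∀ z : EventTriggered.State nx,
      fderiv ℝ (EventTriggered.quadForm P) z (EventTriggered.closedLoopField S G z 0)
        ≤ -α₀ * EventTriggered.quadForm P z) :
    ∃ Ty Tu : EventTriggered.TriggerParams, Ty.Pos ∧ Tu.Pos ∧
      EventTriggered.IsISpS (EventTriggered.Disturbances nw ω₀)
        (EventTriggered.IsTriggeredSolution S G Ty Tu) ∧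
      ∀ w ∈ EventTriggered.Disturbances nw ω₀, ∀ x xh xs ys ty tu,
        EventTriggered.IsTriggeredTrajectory S G Ty Tu w x xh xs ys ty tu →
          EventTriggered.NoZeno ty ∧ EventTriggered.NoZeno tu := by
  obtain ⟨T, k, r, c, hT, hk, hr, hc, hest⟩ :=
    EventTriggered.exists_trigger_estimate hD hFw hp0 hp G hP hα₀ hV
  refine ⟨T, T, hT, hT, ⟨fun w hw z₀ => ?_, ?_⟩, fun w _ x xh xs ys ty tu h => ⟨?_, ?_⟩⟩
  · exact EventTriggered.exists_triggeredSolution hD hFw hp hT.τ_pos hT.τ_pos hw z₀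
  · exact ⟨_, _, c, EventTriggered.classKL_exp hk hr, EventTriggered.classK_mul hc, hc.le,
      hest ω₀⟩
  · exact EventTriggered.noZeno_of_dwell hT.τ_pos h.output_trigger.zero h.output_trigger.wait
  · exact EventTriggered.noZeno_of_dwell hT.τ_pos h.control_trigger.zero h.control_trigger.wait
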